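/- Let $\Theta=(\theta_m)_{m\ge1}$ be a sequence of non-negative reals. For $\sigma\in S_n$ let $C_m(\sigma)$ be the number of cycles of length $m$ of $\sigma$ and $K_{0n}(\sigma)=\sum_{m=1}^n C_m(\sigma)$ the total number of cycles. Put $h_n=\frac1{n!}\sum_{\sigma\in S_n}\prod_{m=1}^n\theta_m^{C_m(\sigma)}$ (so $h_0=1$), and let $\mathbb E_\Theta$ be the expectation on $S_n$ under $\mathbb P_\Theta[\sigma]=\frac1{h_n\,n!}\prod_{m=1}^n\theta_m^{C_m(\sigma)}$ (if $h_n=0$, so that $\mathbb P_\Theta$ is not defined, $h_n\mathbb E_\Theta[\cdot]$ is read as $0$). Let $g_\Theta(t)=\sum_{k\ge1}\frac{\theta_k}{k}t^k$. Let $r>0$ and $\theta\ge0$. A power series $g$ is of class $\mathcal F(r,\theta)$ with constant $K$ if, for some $R>r$ and $0<\phi<\pi/2$, it converges on $|t|<r$ and extends to a holomorphic function on $\Delta_0=\{z:|z|<R,\ z\ne r,\ |\arg(z-r)|>\phi\}$ with $g(t)=\theta\log\frac1{1-t/r}+K+O(t-r)$ as $t\to r$ in $\Delta_0$. For $0<\gamma\le1$,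 it is of class $e\mathcal F(r,\theta,\gamma)$ with constant $K$ if $g(t)=\theta\log\frac1{1-t/r}+g_0(t)$ on $|t|<r$, where $g_0$ is analytic on $|t|<r$ with Taylor coefficients $[t^n]g_0=O(r^{-n}n^{-1-\gamma})$, and $K=g_0(r)=\sum_{n\ge0}[t^n]g_0\,r^n$. (1) For every $w\in\mathbb C$, as formal power series in $t$, $$\sum_{n\ge0}h_n\,\mathbb E_\Theta\bigl[e^{wK_{0n}}\bigr]t^n=\sum_{n\ge0}h_n\,\mathbb E_\Theta\Bigl[e^{w\sum_{m=1}^nC_m}\Bigr]t^n=\exp\bigl(e^w g_\Theta(t)\bigr).$$ (2) If $g_\Theta$ is of class $\mathcal F(r,\theta)$ with constant $K$ and $\theta>0$, then $h_n\neq 0$ for all large $n$ and, as $n\to\infty$, $$\mathbb E_\Theta\bigl[e^{isK_{0n}}\bigr]=n^{\theta(e^{is}-1)}e^{K(e^{is}-1)}\left(\frac{\Gamma(\theta)}{\Gamma(\theta e^{is})}+O\Bigl(\frac1n\Bigr)\right)\quad\text{uniformly in } s\in\mathbb R.$$ (3) If $g_\Theta$ is of class $e\mathcal F(r,\theta,\gamma)$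 with constant $K$ and $\theta>0$, then $h_n\neq 0$ for all large $n$ and, as $n\to\infty$, $$\mathbb E_\Theta\bigl[e^{isK_{0n}}\bigr]=n^{\theta(e^{is}-1)}e^{K(e^{is}-1)}\frac{\Gamma(\theta)}{\Gamma(\theta e^{is})}+O\Bigl(\frac{\log n}{n^\gamma}\Bigr)\quad\text{uniformly in } s\in\mathbb R.$$ Here $1/\Gamma$ is taken to be $0$ at the poles of $\Gamma$ (e.g. $\theta=1$, $s=\pi$). -/

import Mathlib

open Filter Topology Asymptotics

namespace WeightedPerm

noncomputable section

/-- `C_m(σ)`: the number of cycles of length `m` of `σ ∈ S_n`, i.e. the multiplicity of `m` in the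
cycle-type of `σ`, a partition of `n` (fixed points are parts equal to `1`). -/
def cycleCount {n : ℕ} (m : ℕ) (σ : Equiv.Perm (Fin n)) : ℕ :=
  σ.partition.parts.count m

/-- `K_{0n}(σ) = ∑_{m=1}^n C_m(σ)`, the total number of cycles. -/
def totalCycles {n : ℕ} (σ : Equiv.Perm (Fin n)) : ℕ :=
  ∑ m ∈ Finset.Icc 1 n, cycleCount m σ

/-- The unnormalised weight `∏_{m=1}^n θ_m ^ {C_m(σ)}`. Here and below `Θ 0` is never used. -/
def weight (Θ : ℕ → ℝ) {n : ℕ} (σ : Equiv.Perm (Fin n)) : ℝ :=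
  ∏ m ∈ Finset.Icc 1 n, Θ m ^ cycleCount m σ

/-- The normalisation constant `h_n(Θ)`. -/
def h (Θ : ℕ → ℝ) (n : ℕ) : ℝ :=
  (1 / (n.factorial : ℝ)) * ∑ σ : Equiv.Perm (Fin n), weight Θ σ

/-- `ℙ_Θ[σ] = (1 / (h_n n!)) ∏_{m=1}^n θ_m ^ {C_m(σ)}`. -/
def prob (Θ : ℕ → ℝ) {n : ℕ} (σ : Equiv.Perm (Fin n)) : ℝ :=
  1 / (h Θ n * (n.factorial : ℝ)) * weight Θ σ

/-- The expectation `𝔼_Θ[X]` of a complex random variable on `S_n`. -/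
def expect (Θ : ℕ → ℝ) {n : ℕ} (X : Equiv.Perm (Fin n) → ℂ) : ℂ :=
  ∑ σ : Equiv.Perm (Fin n), (prob Θ σ : ℂ) * X σ

/-- `h_0 = 1`. -/
theorem h_zero (Θ : ℕ → ℝ) : h Θ 0 = 1 := by
  simp [h, weight]

/-- `h_n` does normalise the measure as soon as it is nonzero. -/
theorem sum_prob (Θ : ℕ → ℝ) (n : ℕ) (hn : h Θ n ≠ 0) :
    ∑ σ : Equiv.Perm (Fin n), prob Θ σ = 1 := by
  have h2 : (n.factorial : ℝ) ≠ 0 := by positivity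
  have h3 : ∑ σ : Equiv.Perm (Fin n), weight Θ σ = h Θ n * (n.factorial : ℝ) := by
    unfold h
    field_simp
  simp only [prob]
  rw [← Finset.mul_sum, h3]
  field_simp

/-- The formal power series `g_Θ(t) = ∑_{k ≥ 1} (θ_k / k) t^k`. -/
def gSeries (Θ : ℕ → ℝ) : PowerSeries ℂ :=
  PowerSeries.mk fun k => if k = 0 then 0 else (Θ k : ℂ) / (k : ℂ)

/-- `Δ₀(r, R, φ) = {z : |z| < R, z ≠ r, |arg (z - r)| > φ}`. -/
def Delta0 (r R φ : ℝ) : Set ℂ :=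
  {z | ‖z‖ < R ∧ z ≠ (r : ℂ) ∧ φ < |Complex.arg (z - (r : ℂ))|}

/-- The power series `G` is of class `𝓕(r, ϑ)` with constant `K`: the analytic function it defines
on `|t| < r` extends to a function `g` holomorphic in some `Δ₀(r, R, φ)`, with
`g(t) = ϑ log (1 / (1 - t/r)) + K + O(t - r)` as `t → r` in `Δ₀(r, R, φ)`.
(For `0 < r < R` and `φ < π / 2`, `Δ₀(r, R, φ)` contains the disc `|t| < r`.) -/
def IsClassF (G : PowerSeries ℂ) (r ϑ : ℝ) (K : ℂ) : Prop :=
  0 < r ∧ 0 ≤ ϑ ∧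
    ∃ R φ : ℝ, r < R ∧ 0 < φ ∧ φ < Real.pi / 2 ∧
      ∃ g : ℂ → ℂ,
        DifferentiableOn ℂ g (Delta0 r R φ) ∧
        (∀ t : ℂ, ‖t‖ < r → HasSum (fun n : ℕ => PowerSeries.coeff n G * t ^ n) (g t)) ∧
        (fun t : ℂ => g t - ((ϑ : ℂ) * Complex.log (1 / (1 - t / (r : ℂ))) + K))
          =O[𝓝[Delta0 r R φ] (r : ℂ)] (fun t : ℂ => t - (r : ℂ))

/-- The power series `G` is of class `e𝓕(r, ϑ, γ)` with constant `K`: on `|t| < r`,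
`G(t) = ϑ log (1 / (1 - t/r)) + g₀(t)` with `g₀` analytic in `|t| < r` with Taylor coefficients
`b n = O(r^{-n} n^{-1-γ})`, and `K = g₀(r)` is the value of the (absolutely convergent) Taylor
series of `g₀` at `r`. -/
def IsClassEF (G : PowerSeries ℂ) (r ϑ γ : ℝ) (K : ℂ) : Prop :=
  0 < r ∧ 0 ≤ ϑ ∧ 0 < γ ∧ γ ≤ 1 ∧
    ∃ (g₀ : ℂ → ℂ) (b : ℕ → ℂ),
      (∀ t : ℂ, ‖t‖ < r → HasSum (fun n : ℕ => b n * t ^ n) (g₀ t)) ∧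
      (∀ t : ℂ, ‖t‖ < r → HasSum (fun n : ℕ => PowerSeries.coeff n G * t ^ n)
        ((ϑ : ℂ) * Complex.log (1 / (1 - t / (r : ℂ))) + g₀ t)) ∧
      b =O[atTop] (fun n : ℕ => r ^ (-(n : ℝ)) * (n : ℝ) ^ (-1 - γ)) ∧
      HasSum (fun n : ℕ => b n * (r : ℂ) ^ n) K

end

end WeightedPerm

/-! Part (1) is the exponential formula. Permutations of a given cycle type number `n!` divided by
the centralizer order, so the cycle index `Z_n` is a sum over partitions of `n`. Counting each
partition with `n = ∑ m · (multiplicity of m)` and removing one part `m` gives `n Z_n = ∑ x_m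
Z_{n-m}`. This is `A' = G' A` read coefficientwise, and its only solution with constant term `1` is
`exp G` (`cycleIndex_recurrence`, `eq_exp_subst`). The choice `x_m = e^w θ_m` gives the claim.

For (2) and (3) put `w = e^{is}`, so that the characteristic function is `[t^n] exp(w g) / [t^n]
exp(g)`. After rescaling to `r = 1`, the model for `exp(w g)` is `e^{wK} (1 - t)^{-wθ}`. Its
coefficients, normalised by `n^{wθ-1} e^{wK}`, tend to `1/Γ(wθ)` with error `O(1/n)` uniformly on
`|w| = 1` (`exists_bound_risingCoeffNormalized`). What remains is to compare `exp(w g)` with the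
model, uniformly in `w`.

In class `𝓕` the difference is `O(|1 - t|^{1 - θ Re w})` on discs about points of the unit disc that
are small relative to the distance to `1`. The transfer lemma `norm_coeff_le_of_bound_near_disc`
turns this into coefficients `O(n^{θ Re w - 2})`. It avoids Hankel contours: Cauchy estimates on
those discs make a high derivative as singular as `|1 - t|^{-2}` or worse, and `|1 - z|^{-2}` has an
explicit mean over circles inside the disc.

In class `e𝓕`, `exp(w g) = (1 - t)^{-wθ} exp(w g₀)`. The second factor has coefficients
`O(n^{-1-γ})` with sum `e^{wK}`, and `exists_convolution_bound` replaces the convolution by `e^{wK}`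
times the coefficient of the first factor, up to `O(n^{θ-1-γ} log n)`. That error does not shrink
with `Re w`, hence the additive error in (3).

Finally `1/Γ(θ) ≠ 0` for `θ > 0`, so the denominators stay away from `0` and the quotients can be
compared. -/

namespace WeightedPerm

/-! ### Cycle index and the exponential formula -/

open scoped Nat

/-- The size of the centralizer of a permutation whose cycle lengths, fixed points included,
form the multiset `s`. -/
def centralizerCard (s : Multiset ℕ) : ℕ := s.prod * ∏ m ∈ s.toFinset, (s.count m)!

/-- Only the multiplicity of `a` changes, so a single factorial is affected. This permits arguments
that add one part at a time. -/
theorem centralizerCard_cons (a : ℕ) (s : Multiset ℕ) :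
    centralizerCard (a ::ₘ s) = a * (s.count a + 1) * centralizerCard s := by
  have h1 : ∀ t : Multiset ℕ, s.toFinset ⊆ t.toFinset →
      ∏ m ∈ s.toFinset, (s.count m)! = ∏ m ∈ t.toFinset, (s.count m)! := by
    intro t ht
    refine Finset.prod_subset ht fun m _ hm => ?_
    rw [Multiset.mem_toFinset] at hm
    simp [Multiset.count_eq_zero_of_notMem hm]
  have hmem : a ∈ (a ::ₘ s).toFinset := by simp
  unfold centralizerCard
  rw [h1 (a ::ₘ s) (Multiset.toFinset_subset.2 (Multiset.subset_cons s a)),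
    ← Finset.mul_prod_erase _ _ hmem, ← Finset.mul_prod_erase _ (fun m => (s.count m)!) hmem,
    Multiset.prod_cons, Multiset.count_cons_self, Nat.factorial_succ]
  have h2 : ∏ m ∈ (a ::ₘ s).toFinset.erase a, ((a ::ₘ s).count m)! =
      ∏ m ∈ (a ::ₘ s).toFinset.erase a, (s.count m)! :=
    Finset.prod_congr rfl fun m hm => by
      rw [Multiset.count_cons_of_ne (Finset.ne_of_mem_erase hm)]
  rw [h2]
  ring

theorem centralizerCard_pos {s : Multiset ℕ} (hs : ∀ a ∈ s, 0 < a) : 0 < centralizerCard s :=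
  Nat.mul_pos (Nat.pos_of_ne_zero (Multiset.prod_ne_zero fun h => (hs 0 h).false))
    (Finset.prod_pos fun _ _ => Nat.factorial_pos _)

/-- The known count is by `cycleType`, which omits fixed points. Restoring `k` parts equal to `1`
leaves the product of the parts unchanged and contributes `k!` to the centralizer, the factor for
fixed points in that count. -/
theorem card_partition_eq_mul_centralizerCard {α : Type*} [Fintype α] [DecidableEq α]
    (p : (Fintype.card α).Partition) :
    Fintype.card {σ : Equiv.Perm α // σ.partition = p} * centralizerCard p.parts =
      (Fintype.card α)! := by
  set m := p.parts.filter (2 ≤ ·) with hm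
  have hsplit : p.parts = m + Multiset.replicate (Fintype.card α - m.sum) 1 := by
    have h1 : p.parts = m + p.parts.filter (fun a => ¬ 2 ≤ a) :=
      (Multiset.filter_add_not _ _).symm
    have h2 : p.parts.filter (fun a => ¬ 2 ≤ a) =
        Multiset.replicate (Multiset.card (p.parts.filter (fun a => ¬ 2 ≤ a))) 1 := by
      rw [Multiset.eq_replicate]
      refine ⟨rfl, fun b hb => ?_⟩
      rw [Multiset.mem_filter] at hb
      have := p.parts_pos hb.1
      lia
    have h3 := congrArg Multiset.sum h1
    rw [p.parts_sum, h2, Multiset.sum_add, Multiset.sum_replicate] at h3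
    rw [h2] at h1
    have h4 : Fintype.card α - m.sum =
        Multiset.card (p.parts.filter (fun a => ¬ 2 ≤ a)) := by
      rw [smul_eq_mul, mul_one] at h3
      lia
    rw [h4]
    exact h1
  have hsum : m.sum ≤ Fintype.card α := by
    have h3 := congrArg Multiset.sum hsplit
    rw [p.parts_sum, Multiset.sum_add] at h3
    lia
  have h2m : ∀ a ∈ m, 2 ≤ a := fun a ha => (Multiset.mem_filter.1 ha).2
  have hiff : ∀ σ : Equiv.Perm α, σ.partition = p ↔ σ.cycleType = m := by
    intro σ
    constructor
    · rintro rfl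
      rw [hm, Equiv.Perm.filter_parts_partition_eq_cycleType]
    · intro h
      rw [Nat.Partition.ext_iff, hsplit, Equiv.Perm.parts_partition, ← h, Equiv.Perm.sum_cycleType]
  have hcard := Equiv.Perm.card_of_cycleType_mul_eq α m
  rw [if_pos ⟨hsum, h2m⟩] at hcard
  rw [← hcard, Fintype.card_subtype]
  simp_rw [hiff]
  congr 1
  clear hcard hm
  generalize Fintype.card α - m.sum = k at *
  have h1m : m.count 1 = 0 := Multiset.count_eq_zero_of_notMem fun h => by
    have := h2m 1 h
    lia
  rw [hsplit]
  clear hsplit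
  induction k with
  | zero => simp [centralizerCard]
  | succ k ih =>
    rw [Multiset.replicate_succ, Multiset.add_cons, centralizerCard_cons, ih]
    simp [h1m, Nat.factorial_succ, mul_assoc]

/-- The cycle index sum `(1 / n!) ∑_σ ∏_m x_m ^ {C_m(σ)}`. -/
noncomputable def cycleIndex (x : ℕ → ℂ) (n : ℕ) : ℂ :=
  (1 / (n ! : ℂ)) * ∑ σ : Equiv.Perm (Fin n), ∏ m ∈ Finset.Icc 1 n, x m ^ cycleCount m σ

/-- The contribution to the cycle index of the permutations with cycle lengths `s`. -/
noncomputable def partWeight (x : ℕ → ℂ) (s : Multiset ℕ) : ℂ :=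
  (s.map x).prod / (centralizerCard s : ℂ)

/-- The prefactor is exactly what the part `a` contributes to the centralizer order. -/
theorem partWeight_cons (x : ℕ → ℂ) {a : ℕ} (ha : a ≠ 0) (s : Multiset ℕ) :
    (a : ℂ) * ((a ::ₘ s).count a : ℂ) * partWeight x (a ::ₘ s) = x a * partWeight x s := by
  have h1 : (a : ℂ) ≠ 0 := Nat.cast_ne_zero.2 ha
  have h2 : ((s.count a : ℂ) + 1) ≠ 0 := Nat.cast_add_one_ne_zero _
  unfold partWeight
  rw [centralizerCard_cons, Multiset.map_cons, Multiset.prod_cons, Multiset.count_cons_self]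
  push_cast
  rw [← mul_div_assoc, ← mul_div_assoc, mul_div_mul_left _ _ (mul_ne_zero h1 h2)]

theorem sum_perm_eq_sum_partition {α : Type*} [Fintype α] [DecidableEq α]
    (f : Multiset ℕ → ℂ) :
    (1 / ((Fintype.card α)! : ℂ)) * ∑ σ : Equiv.Perm α, f σ.partition.parts =
      ∑ p : (Fintype.card α).Partition, f p.parts / (centralizerCard p.parts : ℂ) := by
  rw [← Finset.sum_fiberwise (s := Finset.univ)
    (g := fun σ : Equiv.Perm α => σ.partition), Finset.mul_sum]
  refine Finset.sum_congr rfl fun p _ => ?_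
  have h1 : ∑ σ ∈ Finset.univ.filter (fun σ : Equiv.Perm α => σ.partition = p),
      f σ.partition.parts =
      (Fintype.card {σ : Equiv.Perm α // σ.partition = p} : ℂ) * f p.parts := by
    rw [Fintype.card_subtype, ← nsmul_eq_mul, ← Finset.sum_const]
    exact Finset.sum_congr rfl fun σ hσ => by rw [(Finset.mem_filter.1 hσ).2]
  have hz : (centralizerCard p.parts : ℂ) ≠ 0 :=
    Nat.cast_ne_zero.2 (centralizerCard_pos fun _ h => p.parts_pos h).ne'
  have hc := congrArg (Nat.cast : ℕ → ℂ) (card_partition_eq_mul_centralizerCard p)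
  push_cast at hc
  have hf : ((Fintype.card α)! : ℂ) ≠ 0 := Nat.cast_ne_zero.2 (Nat.factorial_ne_zero _)
  rw [h1, ← hc] at *
  have h3 := left_ne_zero_of_mul hf
  field_simp

theorem cycleIndex_eq_sum_partition (x : ℕ → ℂ) (n : ℕ) :
    cycleIndex x n = ∑ p : n.Partition, partWeight x p.parts := by
  -- The sum over permutations produces partitions of `Fintype.card (Fin n)`; the index type has to
  -- be transported to partitions of `n`.
  have key : ∀ N : ℕ, N = n → ∑ p : N.Partition, partWeight x p.parts =
      ∑ p : n.Partition, partWeight x p.parts := by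
    rintro N rfl
    rfl
  rw [← key _ (Fintype.card_fin n)]
  unfold partWeight
  rw [← sum_perm_eq_sum_partition (α := Fin n) fun s => (s.map x).prod]
  unfold cycleIndex
  congr 1
  · rw [Fintype.card_fin]
  refine Finset.sum_congr rfl fun σ _ => ?_
  rw [Finset.prod_multiset_map_count]
  refine (Finset.prod_subset (fun m hm => ?_) fun m _ hm => ?_).symm
  · rw [Multiset.mem_toFinset] at hm
    rw [Finset.mem_Icc]
    refine ⟨σ.partition.parts_pos hm, ?_⟩
    simpa using Nat.Partition.le_of_mem_parts hm
  · rw [Multiset.mem_toFinset] at hm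
    simp [cycleCount, Multiset.count_eq_zero_of_notMem hm]

/-- Multiply each partition by `n = ∑ m · count m`, exchange the sums, and for fixed `m` remove one
part `m`: the weight `m · count m` cancels by `partWeight_cons`. -/
theorem cycleIndex_recurrence (x : ℕ → ℂ) (n : ℕ) :
    (n : ℂ) * cycleIndex x n = ∑ m ∈ Finset.Icc 1 n, x m * cycleIndex x (n - m) := by
  have h1 : ∀ p : n.Partition, (n : ℂ) * partWeight x p.parts =
      ∑ m ∈ Finset.Icc 1 n, (m : ℂ) * (p.parts.count m : ℂ) * partWeight x p.parts := by
    intro p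
    rw [← Finset.sum_mul]
    congr 1
    have h := Finset.sum_multiset_count p.parts
    rw [p.parts_sum] at h
    have h' : n = ∑ m ∈ Finset.Icc 1 n, m * p.parts.count m := by
      conv_lhs => rw [h]
      simp only [smul_eq_mul, mul_comm]
      refine Finset.sum_subset (fun m hm => ?_) fun m _ hm => ?_
      · rw [Multiset.mem_toFinset] at hm
        exact Finset.mem_Icc.2 ⟨p.parts_pos hm, Nat.Partition.le_of_mem_parts hm⟩
      · rw [Multiset.mem_toFinset] at hm
        simp [Multiset.count_eq_zero_of_notMem hm]
    exact_mod_cast congrArg (Nat.cast : ℕ → ℂ) h'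
  rw [cycleIndex_eq_sum_partition, Finset.mul_sum, Finset.sum_congr rfl fun p _ => h1 p,
    Finset.sum_comm]
  refine Finset.sum_congr rfl fun m hm => ?_
  rw [Finset.mem_Icc] at hm
  rw [cycleIndex_eq_sum_partition, Finset.mul_sum]
  have h2 : ∀ q : (n - m).Partition, x m * partWeight x q.parts =
      (fun p : {p : n.Partition // m ∈ p.parts} =>
        (m : ℂ) * (p.1.parts.count m : ℂ) * partWeight x p.1.parts)
        ((Nat.Partition.partitionWithPartEquiv hm.1 hm.2).symm q) := by
    intro q
    dsimp only
    rw [Nat.Partition.partitionWithPartEquiv_symm_apply_parts,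
      partWeight_cons x (Nat.one_le_iff_ne_zero.1 hm.1)]
  rw [Finset.sum_congr rfl fun q _ => h2 q,
    Equiv.sum_comp (Nat.Partition.partitionWithPartEquiv hm.1 hm.2).symm
      (fun p : {p : n.Partition // m ∈ p.parts} =>
        (m : ℂ) * (p.1.parts.count m : ℂ) * partWeight x p.1.parts),
    ← Finset.sum_subtype (Finset.univ.filter fun p : n.Partition => m ∈ p.parts) (by simp)
      (fun p : n.Partition => (m : ℂ) * (p.parts.count m : ℂ) * partWeight x p.parts)]
  -- Partitions without a part `m` have multiplicity `0` and contribute nothing.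
  refine (Finset.sum_subset (Finset.filter_subset _ _) fun p _ hp => ?_).symm
  have : m ∉ p.parts := by simpa using hp
  simp [Multiset.count_eq_zero_of_notMem this]

theorem coeff_exp_subst {G : PowerSeries ℂ} (hG : PowerSeries.constantCoeff G = 0) (n : ℕ) :
    PowerSeries.coeff n ((PowerSeries.exp ℂ).subst G) =
      ∑ d ∈ Finset.range (n + 1), (1 / (d ! : ℂ)) * PowerSeries.coeff n (G ^ d) := by
  rw [PowerSeries.coeff_subst' (PowerSeries.HasSubst.of_constantCoeff_zero' hG),
    finsum_eq_sum_of_support_subset]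
  · refine Finset.sum_congr rfl fun d _ => ?_
    simp [PowerSeries.coeff_exp]
  · intro d hd
    by_contra hdn
    apply hd
    simp only [Finset.coe_range, Set.mem_Iio, not_lt] at hdn
    have : PowerSeries.coeff n (G ^ d) = 0 := by
      apply PowerSeries.coeff_of_lt_order
      refine lt_of_lt_of_le ?_ (PowerSeries.le_order_pow_of_constantCoeff_eq_zero d hG)
      exact_mod_cast hdn
    simp [this]

/-- The hypothesis is the differential equation `A' = G' A`. The series `exp G` satisfies it too,
and the recurrence determines every coefficient from the constant term. This is how each exponential
below is recognised. -/
theorem eq_exp_subst {A G : PowerSeries ℂ} (hG : PowerSeries.constantCoeff G = 0)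
    (hA : PowerSeries.coeff 0 A = 1)
    (h : ∀ n : ℕ, ((n : ℂ) + 1) * PowerSeries.coeff (n + 1) A =
      ∑ p ∈ Finset.HasAntidiagonal.antidiagonal n, (((p.1 : ℂ) + 1) * PowerSeries.coeff (p.1 + 1) G) *
        PowerSeries.coeff p.2 A) :
    A = (PowerSeries.exp ℂ).subst G := by
  have hs : PowerSeries.HasSubst G := PowerSeries.HasSubst.of_constantCoeff_zero' hG
  set E : PowerSeries ℂ := (PowerSeries.exp ℂ).subst G with hE
  have hE0 : PowerSeries.coeff 0 E = 1 := by
    rw [hE, coeff_exp_subst hG]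
    simp
  have hE' : ∀ n : ℕ, ((n : ℂ) + 1) * PowerSeries.coeff (n + 1) E =
      ∑ p ∈ Finset.HasAntidiagonal.antidiagonal n, (((p.1 : ℂ) + 1) * PowerSeries.coeff (p.1 + 1) G) *
        PowerSeries.coeff p.2 E := by
    intro n
    have h1 := congrArg (PowerSeries.coeff n)
      (PowerSeries.derivative_subst (f := PowerSeries.exp ℂ) hs)
    rw [PowerSeries.derivative_exp, PowerSeries.coeff_derivative, ← hE, mul_comm E,
      PowerSeries.coeff_mul] at h1
    rw [mul_comm, h1]
    refine Finset.sum_congr rfl fun p _ => ?_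
    rw [PowerSeries.coeff_derivative, mul_comm (PowerSeries.coeff _ G)]
  ext n
  induction n using Nat.strong_induction_on with
  | _ n ih =>
    cases n with
    | zero => rw [hA, hE0]
    | succ n =>
      have h1 : ((n : ℂ) + 1) ≠ 0 := Nat.cast_add_one_ne_zero n
      apply mul_left_cancel₀ h1
      rw [h, hE']
      refine Finset.sum_congr rfl fun p hp => ?_
      rw [ih p.2 (by have := Finset.HasAntidiagonal.mem_antidiagonal.1 hp; lia)]

theorem mk_cycleIndex (x : ℕ → ℂ) :
    PowerSeries.mk (cycleIndex x) = (PowerSeries.exp ℂ).subst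
      (PowerSeries.mk fun k : ℕ => if k = 0 then 0 else x k / (k : ℂ)) := by
  apply eq_exp_subst
  · simp
  · simp [cycleIndex]
  · intro n
    have h := cycleIndex_recurrence x (n + 1)
    rw [PowerSeries.coeff_mk]
    push_cast at h
    rw [h, Finset.Nat.sum_antidiagonal_eq_sum_range_succ_mk, Finset.range_eq_Ico,
      ← Finset.Ico_add_one_right_eq_Icc,
      ← Finset.sum_Ico_add' (fun m => x m * cycleIndex x (n + 1 - m)) 0 (n + 1) 1]
    refine Finset.sum_congr rfl fun k _ => ?_
    have hk : ((k : ℂ) + 1) ≠ 0 := Nat.cast_add_one_ne_zero k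
    simp only [PowerSeries.coeff_mk, Nat.add_sub_add_right, Nat.succ_ne_zero, if_false]
    push_cast
    rw [mul_div_cancel₀ _ hk]

theorem h_mul_expect {Θ : ℕ → ℝ} (hΘ : ∀ m : ℕ, 1 ≤ m → 0 ≤ Θ m) (w : ℂ) (n : ℕ) :
    (h Θ n : ℂ) * expect Θ (fun σ : Equiv.Perm (Fin n) =>
      Complex.exp (w * (totalCycles σ : ℂ))) =
    cycleIndex (fun m => Complex.exp w * (Θ m : ℂ)) n := by
  have hw : ∀ σ : Equiv.Perm (Fin n), 0 ≤ weight Θ σ := fun σ =>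
    Finset.prod_nonneg fun m hm => pow_nonneg (hΘ m (Finset.mem_Icc.1 hm).1) _
  have hn : (n ! : ℝ) ≠ 0 := Nat.cast_ne_zero.2 (Nat.factorial_ne_zero _)
  have hp : ∀ σ : Equiv.Perm (Fin n), h Θ n * prob Θ σ = 1 / (n ! : ℝ) * weight Θ σ := by
    intro σ
    -- If `h_n = 0`, nonnegativity forces every weight to vanish, so both sides are `0`; otherwise
    -- the normalisation cancels.
    by_cases h0 : h Θ n = 0
    · have h1 : ∑ τ : Equiv.Perm (Fin n), weight Θ τ = 0 := by
        have h2 := h0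
        unfold h at h2
        exact (mul_eq_zero.1 h2).resolve_left (one_div_ne_zero hn)
      rw [h0, (Finset.sum_eq_zero_iff_of_nonneg fun τ _ => hw τ).1 h1 σ (Finset.mem_univ σ)]
      simp
    · unfold prob
      field_simp
  unfold expect cycleIndex
  rw [Finset.mul_sum, Finset.mul_sum]
  refine Finset.sum_congr rfl fun σ _ => ?_
  rw [← mul_assoc, ← Complex.ofReal_mul, hp]
  simp_rw [mul_pow]
  rw [Finset.prod_mul_distrib, Finset.prod_pow_eq_pow_sum, ← Complex.exp_nat_mul]
  unfold weight totalCycles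
  push_cast
  rw [mul_comm w]
  ring

theorem mk_h_mul_expect {Θ : ℕ → ℝ} (hΘ : ∀ m : ℕ, 1 ≤ m → 0 ≤ Θ m) (w : ℂ) :
    (PowerSeries.mk fun n : ℕ => (h Θ n : ℂ) * expect Θ (fun σ : Equiv.Perm (Fin n) =>
      Complex.exp (w * (totalCycles σ : ℂ)))) =
    (PowerSeries.exp ℂ).subst (Complex.exp w • gSeries Θ) := by
  have h1 : Complex.exp w • gSeries Θ =
      PowerSeries.mk fun k : ℕ => if k = 0 then 0 else (Complex.exp w * (Θ k : ℂ)) / (k : ℂ) := by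
    ext k
    rw [PowerSeries.coeff_smul, gSeries, PowerSeries.coeff_mk, PowerSeries.coeff_mk]
    split_ifs <;> simp [mul_div_assoc]
  rw [h1, ← mk_cycleIndex]
  exact congrArg PowerSeries.mk (funext fun n => h_mul_expect hΘ w n)

end WeightedPerm

/-! ### Taylor coefficients: from formal to analytic exponentials -/

namespace WeightedPerm

open scoped Nat

section Taylor

variable {a : ℕ → ℂ} {g : ℂ → ℂ}

theorem hasFPowerSeriesOnBall_of_hasSum
    (h : ∀ t : ℂ, ‖t‖ < 1 → HasSum (fun n : ℕ => a n * t ^ n) (g t)) :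
    HasFPowerSeriesOnBall g (FormalMultilinearSeries.ofScalars ℂ a) 0 1 := by
  refine ⟨?_, one_pos, fun {y} hy => ?_⟩
  · refine ENNReal.le_of_forall_nnreal_lt fun r hr => ?_
    have hr1 : ‖((r : ℝ) : ℂ)‖ < 1 := by
      have : ‖((r : ℝ) : ℂ)‖ = r := by simp
      rw [this]
      exact_mod_cast hr
    -- Convergence at the real point `r` makes the terms tend to `0` there, which bounds the radius
    -- below by `r`.
    refine FormalMultilinearSeries.le_radius_of_tendsto _ (l := 0) ?_
    have h1 := (h _ hr1).summable.tendsto_atTop_zero.norm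
    rw [norm_zero] at h1
    refine h1.congr fun n => ?_
    rw [FormalMultilinearSeries.ofScalars_norm, norm_mul, norm_pow]
    simp
  · have hy1 : ‖y‖ < 1 := by
      rw [← ENNReal.ofReal_one, Metric.eball_ofReal, mem_ball_zero_iff] at hy
      exact hy
    rw [zero_add]
    have h1 : ∀ n : ℕ, (FormalMultilinearSeries.ofScalars ℂ a n fun _ => y) = a n * y ^ n :=
      fun n => by simp [mul_comm]
    simpa only [h1] using h y hy1

theorem differentiableOn_of_hasSum
    (h : ∀ t : ℂ, ‖t‖ < 1 → HasSum (fun n : ℕ => a n * t ^ n) (g t)) :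
    DifferentiableOn ℂ g (Metric.ball 0 1) := by
  have := (hasFPowerSeriesOnBall_of_hasSum h).differentiableOn
  rwa [← ENNReal.ofReal_one, Metric.eball_ofReal] at this

theorem iteratedDeriv_of_hasSum
    (h : ∀ t : ℂ, ‖t‖ < 1 → HasSum (fun n : ℕ => a n * t ^ n) (g t)) (n : ℕ) :
    iteratedDeriv n g 0 = (n ! : ℂ) * a n := by
  have := (hasFPowerSeriesOnBall_of_hasSum h).factorial_smul 1 n
  rw [iteratedFDeriv_apply_eq_iteratedDeriv_mul_prod, Finset.prod_const_one, one_smul] at this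
  rw [← this]
  simp

/-- The Taylor series of `exp ∘ g` satisfies the same differential equation as the formal
exponential, by Leibniz applied to `(exp ∘ g)' = g' · (exp ∘ g)`. -/
theorem coeff_exp_subst_eq_iteratedDeriv (h0 : a 0 = 0)
    (h : ∀ t : ℂ, ‖t‖ < 1 → HasSum (fun n : ℕ => a n * t ^ n) (g t)) (n : ℕ) :
    PowerSeries.coeff n ((PowerSeries.exp ℂ).subst (PowerSeries.mk a)) =
      iteratedDeriv n (fun t => Complex.exp (g t)) 0 / (n ! : ℂ) := by
  have hg := differentiableOn_of_hasSum h
  have hga : AnalyticAt ℂ g 0 := hg.analyticAt (Metric.ball_mem_nhds 0 one_pos)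
  have hd : deriv (fun t => Complex.exp (g t)) =ᶠ[𝓝 0]
      deriv g * fun t => Complex.exp (g t) := by
    filter_upwards [Metric.ball_mem_nhds (0 : ℂ) one_pos] with t ht
    have := (hg.differentiableAt (Metric.isOpen_ball.mem_nhds ht)).hasDerivAt.cexp.deriv
    rw [this, Pi.mul_apply, mul_comm]
  have hcd : ∀ m : ℕ, ContDiffAt ℂ m (fun t => Complex.exp (g t)) 0 :=
    fun m => hga.cexp.contDiffAt
  have hfac : ∀ k : ℕ, (k ! : ℂ) ≠ 0 := fun k => Nat.cast_ne_zero.2 (Nat.factorial_ne_zero k)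
  rw [← eq_exp_subst (A := PowerSeries.mk fun n =>
    iteratedDeriv n (fun t => Complex.exp (g t)) 0 / (n ! : ℂ)), PowerSeries.coeff_mk]
  · simpa using h0
  · have : g 0 = 0 := by
      have := iteratedDeriv_of_hasSum h 0
      simpa [h0] using this
    simp [this]
  · intro n
    rw [PowerSeries.coeff_mk, iteratedDeriv_succ', hd.iteratedDeriv_eq,
      iteratedDeriv_mul hga.deriv.contDiffAt (hcd n),
      Finset.Nat.sum_antidiagonal_eq_sum_range_succ_mk, Finset.sum_div, Finset.mul_sum]
    refine Finset.sum_congr rfl fun k hk => ?_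
    have hkn : k ≤ n := Nat.lt_succ_iff.1 (Finset.mem_range.1 hk)
    have h1 : iteratedDeriv k (deriv g) 0 = ((k + 1)! : ℂ) * a (k + 1) := by
      rw [← iteratedDeriv_succ', iteratedDeriv_of_hasSum h]
    have h2 := hfac k
    have h3 := hfac (n - k)
    have h4 := hfac n
    have h5 : ((n : ℂ) + 1) ≠ 0 := Nat.cast_add_one_ne_zero n
    rw [h1, Nat.cast_choose ℂ hkn]
    simp only [PowerSeries.coeff_mk, Nat.factorial_succ]
    push_cast
    field_simp

end Taylor

end WeightedPerm

/-! ### Transfer from growth near the singularity to coefficients -/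

namespace WeightedPerm

open scoped Nat

section Transfer

theorem iteratedDeriv_eq_circleAverage {H : ℂ → ℂ} (hH : DifferentiableOn ℂ H (Metric.ball 0 1))
    {s : ℝ} (hs0 : 0 < s) (hs1 : s < 1) (n : ℕ) :
    iteratedDeriv n H 0 = (n ! : ℂ) * Real.circleAverage (fun z => H z / z ^ n) 0 s := by
  have h1 := (hH.mono (Metric.closedBall_subset_ball hs1)).circleIntegral_one_div_sub_center_pow_smul
    hs0 n
  rw [Real.circleAverage_eq_circleIntegral hs0.ne']
  have h2 : (∮ z in C(0, s), (z - 0)⁻¹ • (H z / z ^ n)) =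
      ∮ z in C(0, s), (1 / (z - 0) ^ (n + 1)) • H z := by
    congr 1
    ext z
    simp only [sub_zero, smul_eq_mul, pow_succ, one_div, mul_inv]
    ring
  have h3 : (n ! : ℂ) ≠ 0 := Nat.cast_ne_zero.2 (Nat.factorial_ne_zero n)
  have h4 := Complex.two_pi_I_ne_zero
  rw [h2, h1, smul_eq_mul, smul_eq_mul]
  field_simp

/-- On `|z| = s` one has `conj z = s² / z`, so `z⁻¹ |1 - z|⁻² = (z - s²)⁻¹ (1 - z)⁻¹`, and Cauchy's
formula at `s²` evaluates the mean. -/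
theorem circleAverage_inv_norm_sq {s : ℝ} (hs0 : 0 < s) (hs1 : s < 1) :
    Real.circleAverage (fun z : ℂ => (‖1 - z‖ ^ 2)⁻¹) 0 s = (1 - s ^ 2)⁻¹ := by
  have hne : ∀ z : ℂ, ‖z‖ ≤ s → 1 - z ≠ 0 := by
    intro z hz h
    have : z = 1 := (sub_eq_zero.1 h).symm
    rw [this, norm_one] at hz
    linarith
  have hd : DifferentiableOn ℂ (fun z : ℂ => (1 - z)⁻¹) (Metric.closedBall 0 s) := by
    intro z hz
    refine DifferentiableAt.differentiableWithinAt ?_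
    refine DifferentiableAt.inv (by fun_prop) (hne z (by simpa using hz))
  have hs2 : ((s ^ 2 : ℝ) : ℂ) ∈ Metric.ball (0 : ℂ) s := by
    rw [mem_ball_zero_iff, Complex.norm_real, Real.norm_of_nonneg (by positivity)]
    nlinarith
  have h1 := hd.circleIntegral_sub_inv_smul hs2
  have h2 : Real.circleAverage (fun z : ℂ => (((‖1 - z‖ ^ 2)⁻¹ : ℝ) : ℂ)) 0 s =
      (((1 - s ^ 2)⁻¹ : ℝ) : ℂ) := by
    rw [Real.circleAverage_eq_circleIntegral hs0.ne']
    have h3 : (∮ z in C(0, s), (z - 0)⁻¹ • (((‖1 - z‖ ^ 2)⁻¹ : ℝ) : ℂ)) =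
        ∮ z in C(0, s), (z - ((s ^ 2 : ℝ) : ℂ))⁻¹ • (1 - z)⁻¹ := by
      refine circleIntegral.integral_congr hs0.le fun z hz => ?_
      rw [mem_sphere_zero_iff_norm] at hz
      have hz0 : z ≠ 0 := by
        rw [← norm_pos_iff, hz]
        exact hs0
      have hzz : z * (starRingEnd ℂ) z = ((s ^ 2 : ℝ) : ℂ) := by
        rw [Complex.mul_conj, Complex.normSq_eq_norm_sq, hz]
      have hn : ((‖1 - z‖ ^ 2 : ℝ) : ℂ) = (1 - z) * (1 - (starRingEnd ℂ) z) := by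
        rw [← Complex.normSq_eq_norm_sq, ← Complex.mul_conj, map_sub, map_one]
      rw [Complex.ofReal_inv, hn, ← hzz, sub_zero, smul_eq_mul, smul_eq_mul]
      have h4 : z - z * (starRingEnd ℂ) z = z * (1 - (starRingEnd ℂ) z) := by ring
      rw [h4, mul_inv, mul_inv]
      ring
    rw [h3, h1, inv_smul_smul₀ Complex.two_pi_I_ne_zero]
    push_cast
    rfl
  have h5 : Real.circleAverage (fun z : ℂ => (((‖1 - z‖ ^ 2)⁻¹ : ℝ) : ℂ)) 0 s =
      ((Real.circleAverage (fun z : ℂ => (‖1 - z‖ ^ 2)⁻¹) 0 s : ℝ) : ℂ) := by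
    rw [Real.circleAverage, Real.circleAverage, intervalIntegral.integral_ofReal]
    simp
  rw [h5] at h2
  exact_mod_cast h2

theorem norm_iteratedDeriv_le_of_norm_le_inv_sq {H : ℂ → ℂ}
    (hH : DifferentiableOn ℂ H (Metric.ball 0 1)) {s B : ℝ} (hs0 : 0 < s) (hs1 : s < 1)
    (hB : ∀ z : ℂ, ‖z‖ = s → ‖H z‖ ≤ B * (‖1 - z‖ ^ 2)⁻¹) (n : ℕ) :
    ‖iteratedDeriv n H 0‖ ≤ (n ! : ℝ) * (B / s ^ n * (1 - s ^ 2)⁻¹) := by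
  rw [iteratedDeriv_eq_circleAverage hH hs0 hs1, norm_mul, Complex.norm_natCast]
  refine mul_le_mul_of_nonneg_left ?_ (Nat.cast_nonneg _)
  rw [← circleAverage_inv_norm_sq hs0 hs1, ← smul_eq_mul, ← Real.circleAverage_smul]
  rw [Real.circleAverage, Real.circleAverage, norm_smul, Real.norm_of_nonneg (by positivity),
    smul_eq_mul]
  refine mul_le_mul_of_nonneg_left ?_ (by positivity)
  have hcm : ∀ x : ℝ, ‖circleMap 0 s x‖ = s := fun x => by
    simp [abs_of_pos hs0]
  refine intervalIntegral.norm_integral_le_of_norm_le (by positivity)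
    (Eventually.of_forall fun x _ => ?_) ?_
  · have := hB _ (hcm x)
    rw [norm_div, norm_pow, hcm, Pi.smul_apply, smul_eq_mul, div_mul_eq_mul_div]
    exact div_le_div_of_nonneg_right this (by positivity)
  · apply Continuous.intervalIntegrable
    refine Continuous.const_smul (Continuous.inv₀ (by fun_prop) fun x => ?_) _
    refine pow_ne_zero _ (norm_ne_zero_iff.2 fun h => ?_)
    have := hcm x
    rw [← sub_eq_zero.1 h, norm_one] at this
    linarith

/-- With `N = n + k`, Cauchy estimates give `|F^{(k)}(t)| ≲ M |1 - t|^{a-k}`. On a circle at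
distance `1/(n+1)` from `1` the excess over `|1 - t|⁻²` costs `(n+1)^{k-a-2}`, the mean of `|1 -
z|⁻²` costs `n + 1`, and `n!/(n+k)! ≤ (n+1)^{-k}`; the product is `(n+1)^{-a-1}`. The constant
depends only on `c` and `k`, which later gives uniformity in `w`. -/
theorem norm_coeff_le_of_bound_near_disc {c : ℝ} (hc0 : 0 < c) (k : ℕ) :
    ∃ C : ℝ, 0 ≤ C ∧ ∀ (F : ℂ → ℂ) (M a : ℝ), 0 ≤ M → a + 2 ≤ k → 1 ≤ k →
      DifferentiableOn ℂ F (Metric.ball 0 1) →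
      (∀ t : ℂ, ‖t‖ < 1 → DifferentiableOn ℂ F (Metric.closedBall t (c * ‖1 - t‖)) ∧
        ∀ z ∈ Metric.sphere t (c * ‖1 - t‖), ‖F z‖ ≤ M * ‖1 - t‖ ^ a) →
      ∀ N : ℕ, k < N → ‖iteratedDeriv N F 0 / (N ! : ℂ)‖ ≤ C * M * (N : ℝ) ^ (-a - 1) := by
  refine ⟨Real.exp 1 * ((k ! : ℝ) / c ^ k) * ((k : ℝ) + 1) ^ k, by positivity, ?_⟩
  intro F M a hM hak hk hF hb N hN
  obtain ⟨n, rfl⟩ : ∃ n, N = n + k := ⟨N - k, by lia⟩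
  have hn : 1 ≤ n := by lia
  have hn0 : (0 : ℝ) < n := by exact_mod_cast hn
  -- This radius has `1 - s = 1/(n+1)`, while `s^{-n}` stays below `e`.
  set s : ℝ := n / (n + 1) with hs
  have hs0 : 0 < s := by positivity
  have hs1 : s < 1 := by
    rw [hs, div_lt_one (by positivity)]
    linarith
  have h1s : 1 - s = ((n : ℝ) + 1)⁻¹ := by
    rw [hs]
    field_simp
    ring
  have hpos : ∀ t : ℂ, ‖t‖ < 1 → 0 < ‖1 - t‖ := by
    intro t ht
    rw [norm_pos_iff]
    intro h
    rw [← sub_eq_zero.1 h, norm_one] at ht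
    linarith
  have hH : DifferentiableOn ℂ (iteratedDeriv k F) (Metric.ball 0 1) := by
    rw [iteratedDeriv_eq_iterate]
    exact ((hF.analyticOnNhd Metric.isOpen_ball).iterated_deriv k).differentiableOn
  have hder : ∀ t : ℂ, ‖t‖ < 1 →
      ‖iteratedDeriv k F t‖ ≤ (k ! : ℝ) / c ^ k * M * ‖1 - t‖ ^ (a - k) := by
    intro t ht
    have h0 := hpos t ht
    have := Complex.norm_iteratedDeriv_le_of_forall_mem_sphere_norm_le k (mul_pos hc0 h0)
      ((hb t ht).1.mono Metric.closure_ball_subset_closedBall).diffContOnCl (hb t ht).2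
    refine this.trans (le_of_eq ?_)
    rw [Real.rpow_sub h0, Real.rpow_natCast, mul_pow]
    field_simp
  have hB : ∀ z : ℂ, ‖z‖ = s → ‖iteratedDeriv k F z‖ ≤
      ((k ! : ℝ) / c ^ k * M * ((n : ℝ) + 1) ^ (k - a - 2)) * (‖1 - z‖ ^ 2)⁻¹ := by
    intro z hz
    have h0 := hpos z (hz ▸ hs1)
    refine (hder z (hz ▸ hs1)).trans ?_
    rw [mul_assoc _ _ ((‖1 - z‖ ^ 2)⁻¹)]
    refine mul_le_mul_of_nonneg_left ?_ (by positivity)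
    have h1 : ‖1 - z‖ ^ (a - k) = ‖1 - z‖ ^ (-(k - a - 2)) * (‖1 - z‖ ^ 2)⁻¹ := by
      rw [← Real.rpow_natCast, ← Real.rpow_neg h0.le, ← Real.rpow_add h0]
      congr 1
      push_cast
      ring
    rw [h1]
    refine mul_le_mul_of_nonneg_right ?_ (by positivity)
    have h2 : ((n : ℝ) + 1)⁻¹ ≤ ‖1 - z‖ := by
      rw [← h1s, ← hz]
      simpa using norm_sub_norm_le (1 : ℂ) z
    calc ‖1 - z‖ ^ (-(k - a - 2)) ≤ (((n : ℝ) + 1)⁻¹) ^ (-(k - a - 2)) :=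
          Real.rpow_le_rpow_of_nonpos (by positivity) h2 (by linarith)
      _ = ((n : ℝ) + 1) ^ (k - a - 2) := by
          rw [Real.inv_rpow (by positivity), ← Real.rpow_neg (by positivity), neg_neg]
  have hmain := norm_iteratedDeriv_le_of_norm_le_inv_sq hH hs0 hs1 hB n
  have hcomp : iteratedDeriv n (iteratedDeriv k F) 0 = iteratedDeriv (n + k) F 0 := by
    simp only [iteratedDeriv_eq_iterate, Function.iterate_add_apply]
  rw [hcomp] at hmain
  have hspow : (s ^ n)⁻¹ ≤ Real.exp 1 := by
    have h1 : s⁻¹ ≤ Real.exp (1 / n) := by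
      have := Real.add_one_le_exp (1 / (n : ℝ))
      refine le_trans (le_of_eq ?_) this
      rw [hs]
      field_simp
      ring
    rw [← inv_pow]
    calc (s⁻¹) ^ n ≤ Real.exp (1 / n) ^ n := pow_le_pow_left₀ (by positivity) h1 n
      _ = Real.exp 1 := by
        rw [← Real.exp_nat_mul]
        congr 1
        field_simp
  have hsq : (1 - s ^ 2)⁻¹ ≤ (n : ℝ) + 1 := by
    rw [← inv_inv ((n : ℝ) + 1), ← h1s]
    exact inv_anti₀ (by linarith) (by nlinarith)
  have hfac : (n ! : ℝ) * ((n : ℝ) + 1) ^ k ≤ ((n + k)! : ℝ) := by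
    exact_mod_cast Nat.factorial_mul_pow_le_factorial
  rw [norm_div, Complex.norm_natCast, div_le_iff₀ (by positivity)]
  have hn1 : (0 : ℝ) < (n : ℝ) + 1 := by positivity
  have hexp : ((n : ℝ) + 1) ^ (k - a - 2) * ((n : ℝ) + 1) =
      ((n : ℝ) + 1) ^ (-a - 1) * ((n : ℝ) + 1) ^ k := by
    rw [← Real.rpow_natCast, ← Real.rpow_add hn1]
    nth_rewrite 2 [← Real.rpow_one ((n : ℝ) + 1)]
    rw [← Real.rpow_add hn1]
    congr 1
    ring
  -- The ratio `(n+k)/(n+1)` lies between `1` and `k + 1`, and `a + 1 ≤ k`, so passing from `n + 1`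
  -- to `N` costs at most `(k+1)^k`.
  have hcmp : ((n : ℝ) + 1) ^ (-a - 1) ≤
      ((k : ℝ) + 1) ^ k * (((n + k : ℕ) : ℝ)) ^ (-a - 1) := by
    have hN0 : (0 : ℝ) < ((n + k : ℕ) : ℝ) := by positivity
    have hx1 : 1 ≤ ((n + k : ℕ) : ℝ) / ((n : ℝ) + 1) := by
      rw [one_le_div hn1]
      push_cast
      have : (1 : ℝ) ≤ k := by exact_mod_cast hk
      linarith
    have hx2 : ((n + k : ℕ) : ℝ) / ((n : ℝ) + 1) ≤ (k : ℝ) + 1 := by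
      rw [div_le_iff₀ hn1]
      push_cast
      nlinarith [(Nat.cast_nonneg k : (0 : ℝ) ≤ k)]
    have h3 : (((n + k : ℕ) : ℝ) / ((n : ℝ) + 1)) ^ (a + 1) ≤ ((k : ℝ) + 1) ^ k := by
      calc _ ≤ (((n + k : ℕ) : ℝ) / ((n : ℝ) + 1)) ^ (k : ℝ) :=
            Real.rpow_le_rpow_of_exponent_le hx1 (by linarith)
        _ = (((n + k : ℕ) : ℝ) / ((n : ℝ) + 1)) ^ k := Real.rpow_natCast _ _
        _ ≤ _ := pow_le_pow_left₀ (by positivity) hx2 k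
    calc ((n : ℝ) + 1) ^ (-a - 1) = (((n + k : ℕ) : ℝ) / ((n : ℝ) + 1)) ^ (a + 1) *
          ((n + k : ℕ) : ℝ) ^ (-a - 1) := by
          rw [Real.div_rpow hN0.le hn1.le, show -a - 1 = -(a + 1) by ring,
            Real.rpow_neg hN0.le, Real.rpow_neg hn1.le]
          field_simp
      _ ≤ _ := mul_le_mul_of_nonneg_right h3 (by positivity)
  set P : ℝ := (k ! : ℝ) / c ^ k with hP
  have hP0 : 0 ≤ P := by positivity
  calc ‖iteratedDeriv (n + k) F 0‖
      ≤ (n ! : ℝ) * (P * M * ((n : ℝ) + 1) ^ (k - a - 2) * (s ^ n)⁻¹ * (1 - s ^ 2)⁻¹) := by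
        simpa only [div_eq_mul_inv] using hmain
    _ ≤ (n ! : ℝ) * (P * M * ((n : ℝ) + 1) ^ (k - a - 2) * Real.exp 1 * ((n : ℝ) + 1)) := by
        have : 0 ≤ (1 - s ^ 2)⁻¹ := inv_nonneg.2 (by nlinarith)
        gcongr
    _ = Real.exp 1 * P * M * ((n : ℝ) + 1) ^ (-a - 1) * ((n ! : ℝ) * ((n : ℝ) + 1) ^ k) := by
        linear_combination (n ! : ℝ) * P * M * Real.exp 1 * hexp
    _ ≤ Real.exp 1 * P * M * (((k : ℝ) + 1) ^ k * (((n + k : ℕ) : ℝ)) ^ (-a - 1)) *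
          ((n + k)! : ℝ) := by
        gcongr
    _ = _ := by ring

end Transfer

end WeightedPerm

/-! ### Coefficients of `(1 - t)^{-α}`, uniformly in `α` -/

namespace WeightedPerm

open scoped Nat

section RisingCoeff

/-- The Taylor coefficient `α (α + 1) ⋯ (α + n - 1) / n!` of `(1 - t) ^ (-α)`. -/
noncomputable def risingCoeff (α : ℂ) (n : ℕ) : ℂ :=
  (∏ j ∈ Finset.range n, (α + j)) / (n ! : ℂ)

theorem risingCoeff_succ (α : ℂ) (n : ℕ) :
    ((n : ℂ) + 1) * risingCoeff α (n + 1) = (α + n) * risingCoeff α n := by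
  have h1 : ((n : ℂ) + 1) ≠ 0 := Nat.cast_add_one_ne_zero n
  have h2 : (n ! : ℂ) ≠ 0 := Nat.cast_ne_zero.2 (Nat.factorial_ne_zero n)
  unfold risingCoeff
  rw [Finset.prod_range_succ, Nat.factorial_succ]
  push_cast
  field_simp

theorem mul_sum_risingCoeff (α : ℂ) (n : ℕ) :
    α * ∑ j ∈ Finset.range n, risingCoeff α j = n * risingCoeff α n := by
  induction n with
  | zero => simp
  | succ n ih =>
    rw [Finset.sum_range_succ, mul_add, ih]
    push_cast
    rw [risingCoeff_succ]
    ring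

/-- The exponent is `-α log(1 - t)`; its constant term is written `α / 0`, which is `0`. With `G' =
α/(1 - t)`, the equation `A' = G' A` is `mul_sum_risingCoeff`. -/
theorem mk_risingCoeff (α : ℂ) :
    PowerSeries.mk (risingCoeff α) =
      (PowerSeries.exp ℂ).subst (PowerSeries.mk fun n : ℕ => α / (n : ℂ)) := by
  apply eq_exp_subst
  · simp
  · simp [risingCoeff]
  · intro n
    rw [PowerSeries.coeff_mk]
    have h := mul_sum_risingCoeff α (n + 1)
    push_cast at h
    rw [← h, Finset.Nat.sum_antidiagonal_eq_sum_range_succ_mk, Finset.mul_sum,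
      ← Finset.sum_range_reflect]
    refine Finset.sum_congr rfl fun k _ => ?_
    have hk : ((k : ℂ) + 1) ≠ 0 := Nat.cast_add_one_ne_zero k
    simp only [PowerSeries.coeff_mk, Nat.add_sub_cancel]
    push_cast
    rw [mul_div_cancel₀ _ hk]

/-- `risingCoeff α n` normalised by its asymptotic order. -/
noncomputable def risingCoeffNormalized (α : ℂ) (n : ℕ) : ℂ :=
  risingCoeff α n * (n : ℂ) ^ (1 - α)

theorem risingCoeff_eq (α : ℂ) {n : ℕ} (hn : 1 ≤ n) :
    risingCoeff α n = risingCoeffNormalized α n * (n : ℂ) ^ (α - 1) := by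
  have h0 : (n : ℂ) ≠ 0 := Nat.cast_ne_zero.2 (Nat.one_le_iff_ne_zero.1 hn)
  rw [risingCoeffNormalized, mul_assoc, ← Complex.cpow_add _ _ h0]
  simp

/-- This is Euler's limit for `Γ`, inverted. At a pole the products eventually contain the factor
`0`, which agrees with the convention `1/Γ = 0` there. -/
theorem tendsto_risingCoeffNormalized (α : ℂ) :
    Tendsto (risingCoeffNormalized α) atTop (𝓝 (Complex.Gamma α)⁻¹) := by
  by_cases hα : ∃ m : ℕ, α = -m
  · obtain ⟨m, hm⟩ := hα
    rw [(Complex.Gamma_eq_zero_iff α).2 ⟨m, hm⟩, inv_zero]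
    refine tendsto_const_nhds.congr' ?_
    filter_upwards [eventually_gt_atTop m] with n hn
    have : ∏ j ∈ Finset.range n, (α + j) = 0 :=
      Finset.prod_eq_zero (Finset.mem_range.2 hn) (by rw [hm]; ring)
    simp [risingCoeffNormalized, risingCoeff, this]
  · push Not at hα
    have h1 := (Complex.GammaSeq_tendsto_Gamma α).inv₀ (Complex.Gamma_ne_zero hα)
    have h2 : Tendsto (fun n : ℕ => (1 + α / (n : ℂ))⁻¹) atTop (𝓝 1) := by
      have h3 : Tendsto (fun n : ℕ => 1 + α / (n : ℂ)) atTop (𝓝 (1 + 0)) :=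
        tendsto_const_nhds.add (tendsto_const_div_atTop_nhds_zero_nat α)
      rw [add_zero] at h3
      simpa using h3.inv₀ one_ne_zero
    have h3 := h1.mul h2
    rw [mul_one] at h3
    refine h3.congr' ?_
    filter_upwards [eventually_ge_atTop 1] with n hn
    have h0 : (n : ℂ) ≠ 0 := Nat.cast_ne_zero.2 (Nat.one_le_iff_ne_zero.1 hn)
    have hαn : α + n ≠ 0 := fun h => hα n (eq_neg_of_add_eq_zero_left h)
    have hf : (n ! : ℂ) ≠ 0 := Nat.cast_ne_zero.2 (Nat.factorial_ne_zero n)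
    have hp : (n : ℂ) ^ α ≠ 0 := by simp [Complex.cpow_eq_zero_iff, h0]
    rw [Complex.GammaSeq, Finset.prod_range_succ, risingCoeffNormalized, risingCoeff,
      Complex.cpow_sub _ _ h0, Complex.cpow_one]
    have h4 : 1 + α / (n : ℂ) = (α + n) / n := by
      field_simp
      ring
    rw [h4]
    field_simp

theorem risingCoeffNormalized_succ (α : ℂ) {n : ℕ} (hn : 1 ≤ n) :
    risingCoeffNormalized α (n + 1) = risingCoeffNormalized α n *
      ((1 + (α - 1) * ((1 / (n + 1) : ℝ) : ℂ)) *
        Complex.exp (-((α - 1) * (Real.log (1 + 1 / n) : ℂ)))) := by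
  have h0 : (n : ℂ) ≠ 0 := Nat.cast_ne_zero.2 (Nat.one_le_iff_ne_zero.1 hn)
  have hr0 : (0 : ℝ) < n := by exact_mod_cast hn
  have h1 : ((n : ℂ) + 1) ≠ 0 := Nat.cast_add_one_ne_zero n
  have hc : risingCoeff α (n + 1) =
      risingCoeff α n * (1 + (α - 1) * ((1 / (n + 1) : ℝ) : ℂ)) := by
    apply mul_left_cancel₀ h1
    rw [risingCoeff_succ]
    push_cast
    field_simp
    ring
  have hpow : ((n + 1 : ℕ) : ℂ) ^ (1 - α) = (n : ℂ) ^ (1 - α) *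
      Complex.exp (-((α - 1) * (Real.log (1 + 1 / n) : ℂ))) := by
    have h2 : ((n + 1 : ℕ) : ℂ) = ((n : ℝ) : ℂ) * ((1 + 1 / n : ℝ) : ℂ) := by
      push_cast
      field_simp
    have h3 : (0 : ℝ) < 1 + 1 / n := by positivity
    rw [h2, Complex.mul_cpow_ofReal_nonneg hr0.le h3.le, Complex.ofReal_natCast]
    congr 1
    rw [Complex.cpow_def_of_ne_zero (by exact_mod_cast h3.ne'), ← Complex.ofReal_log h3.le]
    congr 1
    ring
  rw [risingCoeffNormalized, risingCoeffNormalized, hc, hpow]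
  ring

/-- The first-order terms cancel because `1/(n+1)` and `log(1 + 1/n)` differ by at most `1/n²`. -/
theorem norm_one_add_mul_exp_sub_one_le {β : ℂ} {B : ℝ} (hβ : ‖β‖ ≤ B) {n : ℕ} (hn : 1 ≤ n) :
    ‖(1 + β * ((1 / (n + 1) : ℝ) : ℂ)) * Complex.exp (-(β * (Real.log (1 + 1 / n) : ℂ))) - 1‖ ≤
      Real.exp B * (B + B ^ 2 * Real.exp B) * (1 / (n : ℝ) ^ 2) := by
  have hB : 0 ≤ B := (norm_nonneg β).trans hβ
  have hn0 : (1 : ℝ) ≤ n := by exact_mod_cast hn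
  have hpos : (0 : ℝ) < 1 + 1 / n := by positivity
  set L := Real.log (1 + 1 / (n : ℝ)) with hL
  have hL1 : L ≤ 1 / n := by
    have := Real.log_le_sub_one_of_pos hpos
    linarith
  have hL2 : 1 / ((n : ℝ) + 1) ≤ L := by
    have h := Real.one_sub_inv_le_log_of_pos hpos
    refine le_trans (le_of_eq ?_) h
    field_simp
    ring
  have hL0 : 0 ≤ L := le_trans (by positivity) hL2
  have hLle : L ≤ 1 := hL1.trans (by rw [div_le_one (by linarith)]; exact hn0)
  have hβL : ‖β * (L : ℂ)‖ ≤ B * L := by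
    rw [norm_mul, Complex.norm_real, Real.norm_of_nonneg hL0]
    exact mul_le_mul_of_nonneg_right hβ hL0
  have hβL1 : ‖β * (L : ℂ)‖ ≤ B := hβL.trans (mul_le_of_le_one_right hB hLle)
  have hid : (1 + β * ((1 / (n + 1) : ℝ) : ℂ)) * Complex.exp (-(β * (L : ℂ))) - 1 =
      Complex.exp (-(β * (L : ℂ))) * (β * ((1 / (n + 1) - L : ℝ) : ℂ) -
        (Complex.exp (β * (L : ℂ)) - (1 + β * (L : ℂ)))) := by
    have : Complex.exp (-(β * (L : ℂ))) * Complex.exp (β * (L : ℂ)) = 1 := by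
      rw [← Complex.exp_add]
      simp
    push_cast
    linear_combination this
  have h1 : ‖Complex.exp (-(β * (L : ℂ)))‖ ≤ Real.exp B := by
    refine (Complex.norm_exp_le_exp_norm _).trans (Real.exp_le_exp.2 ?_)
    rwa [norm_neg]
  have h2 : ‖β * ((1 / (n + 1) - L : ℝ) : ℂ)‖ ≤ B * (1 / (n : ℝ) ^ 2) := by
    rw [norm_mul, Complex.norm_real, Real.norm_of_nonpos (by linarith)]
    refine mul_le_mul hβ ?_ (by linarith) hB
    have : 1 / (n : ℝ) - 1 / ((n : ℝ) + 1) ≤ 1 / (n : ℝ) ^ 2 := by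
      have h3 : 1 / (n : ℝ) - 1 / ((n : ℝ) + 1) = 1 / ((n : ℝ) * (n + 1)) := by
        field_simp
        ring
      rw [h3]
      exact one_div_le_one_div_of_le (by positivity) (by nlinarith)
    linarith
  have h3 : ‖Complex.exp (β * (L : ℂ)) - (1 + β * (L : ℂ))‖ ≤
      B ^ 2 * Real.exp B * (1 / (n : ℝ) ^ 2) := by
    have h4 := Complex.norm_exp_sub_sum_le_norm_mul_exp (β * (L : ℂ)) 2
    simp only [Finset.sum_range_succ, Finset.sum_range_zero, pow_zero, Nat.factorial_zero,
      Nat.cast_one, div_one, pow_one, Nat.factorial_one, zero_add] at h4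
    refine h4.trans ?_
    have h5 : ‖β * (L : ℂ)‖ ^ 2 ≤ (B * (1 / n)) ^ 2 :=
      pow_le_pow_left₀ (norm_nonneg _) (hβL.trans (mul_le_mul_of_nonneg_left hL1 hB)) 2
    calc _ ≤ (B * (1 / (n : ℝ))) ^ 2 * Real.exp B :=
          mul_le_mul h5 (Real.exp_le_exp.2 hβL1) (by positivity) (by positivity)
      _ = _ := by ring
  rw [hid, norm_mul, mul_assoc]
  refine mul_le_mul h1 ?_ (norm_nonneg _) (by positivity)
  calc _ ≤ _ := norm_sub_le _ _
    _ ≤ _ := add_le_add h2 h3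
    _ = _ := by ring

/-- Consecutive ratios are `1 + O(1/n²)`, uniformly for `|α| ≤ M`. Hence the sequence is bounded and
its distance to the limit is at most the tail `∑_{m ≥ n} O(1/m²) = O(1/n)`. No division by the limit
occurs, so zeros of `1/Γ` do no harm. -/
theorem exists_bound_risingCoeffNormalized (M : ℝ) :
    ∃ C : ℝ, 0 ≤ C ∧ ∀ α : ℂ, ‖α‖ ≤ M → ‖(Complex.Gamma α)⁻¹‖ ≤ C ∧
      ∀ n : ℕ, 1 ≤ n → ‖risingCoeffNormalized α n‖ ≤ C ∧
        ‖risingCoeffNormalized α n - (Complex.Gamma α)⁻¹‖ ≤ C * (1 / n) := by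
  by_cases hM : 0 ≤ M
  swap
  · exact ⟨0, le_rfl, fun α hα => absurd ((norm_nonneg α).trans hα) hM⟩
  set D : ℝ := Real.exp (M + 1) * ((M + 1) + (M + 1) ^ 2 * Real.exp (M + 1)) with hD
  have hD0 : 0 ≤ D := by positivity
  set U : ℝ := M * Real.exp (2 * D) with hU
  have hU0 : 0 ≤ U := by positivity
  have hstep : ∀ α : ℂ, ‖α‖ ≤ M → ∀ n : ℕ, 1 ≤ n →
      ‖risingCoeffNormalized α (n + 1) - risingCoeffNormalized α n‖ ≤
        ‖risingCoeffNormalized α n‖ * (2 * D * (1 / n - 1 / (n + 1))) := by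
    intro α hα n hn
    have hn0 : (1 : ℝ) ≤ n := by exact_mod_cast hn
    have hβ : ‖α - 1‖ ≤ M + 1 := by
      have := norm_sub_le α 1
      rw [norm_one] at this
      linarith
    rw [risingCoeffNormalized_succ α hn, ← mul_sub_one, norm_mul]
    refine mul_le_mul_of_nonneg_left ?_ (norm_nonneg _)
    refine (norm_one_add_mul_exp_sub_one_le hβ hn).trans ?_
    rw [← hD, mul_comm 2 D, mul_assoc D]
    refine mul_le_mul_of_nonneg_left ?_ hD0
    -- The bound `1/n² ≤ 2 (1/n - 1/(n+1))` makes the sums telescope.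
    have h3 : 2 * (1 / (n : ℝ) - 1 / ((n : ℝ) + 1)) = 1 / ((n : ℝ) * (n + 1) / 2) := by
      field_simp
      ring
    rw [h3]
    exact one_div_le_one_div_of_le (by positivity) (by nlinarith)
  have hbound : ∀ α : ℂ, ‖α‖ ≤ M → ∀ n : ℕ, 1 ≤ n → ‖risingCoeffNormalized α n‖ ≤ U := by
    intro α hα n hn
    have hn0 : (1 : ℝ) ≤ n := by exact_mod_cast hn
    -- The exponent carries the telescoped sum of the increments so far, which closes the induction;
    -- at `n = 1` the normalised coefficient is `α` itself.
    suffices h : ‖risingCoeffNormalized α n‖ ≤ M * Real.exp (2 * D * (1 - 1 / n)) by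
      refine h.trans (mul_le_mul_of_nonneg_left (Real.exp_le_exp.2 ?_) hM)
      have : (0 : ℝ) ≤ 1 / n := by positivity
      nlinarith
    clear hn0
    induction n, hn using Nat.le_induction with
    | base => simpa [risingCoeffNormalized, risingCoeff] using hα
    | succ n hn ih =>
      have h1 := hstep α hα n hn
      have h2 : ‖risingCoeffNormalized α (n + 1)‖ ≤
          ‖risingCoeffNormalized α n‖ * (2 * D * (1 / n - 1 / (n + 1)) + 1) := by
        have := norm_le_norm_add_norm_sub' (risingCoeffNormalized α (n + 1))
          (risingCoeffNormalized α n)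
        linarith
      refine h2.trans ((mul_le_mul ih (Real.add_one_le_exp _) ?_ (by positivity)).trans
        (le_of_eq ?_))
      · have hn0 : (1 : ℝ) ≤ n := by exact_mod_cast hn
        have : 1 / ((n : ℝ) + 1) ≤ 1 / n := one_div_le_one_div_of_le (by linarith) (by linarith)
        have := mul_nonneg hD0 (sub_nonneg.2 this)
        linarith
      · rw [mul_assoc, ← Real.exp_add]
        push_cast
        congr 2
        ring
  refine ⟨U + 2 * U * D, by positivity, fun α hα => ?_⟩
  have hUD : 0 ≤ 2 * U * D := by positivity
  refine ⟨?_, fun n hn => ⟨(hbound α hα n hn).trans (by linarith), ?_⟩⟩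
  · refine le_trans (le_of_tendsto (tendsto_risingCoeffNormalized α).norm ?_)
      (le_add_of_nonneg_right hUD)
    filter_upwards [eventually_ge_atTop 1] with n hn using hbound α hα n hn
  · have hn0 : (1 : ℝ) ≤ n := by exact_mod_cast hn
    have htel : ∀ m : ℕ, n ≤ m → ‖risingCoeffNormalized α n - risingCoeffNormalized α m‖ ≤
        2 * U * D * (1 / n - 1 / m) := by
      intro m hm
      induction m, hm using Nat.le_induction with
      | base => simp
      | succ m hm ih =>
        have h1 := hstep α hα m (hn.trans hm)
        have hm0 : (1 : ℝ) ≤ m := by exact_mod_cast hn.trans hm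
        have h3 : 0 ≤ 2 * D * (1 / (m : ℝ) - 1 / (m + 1)) := by
          have : 1 / ((m : ℝ) + 1) ≤ 1 / m :=
            one_div_le_one_div_of_le (by linarith) (by linarith)
          have := mul_nonneg hD0 (sub_nonneg.2 this)
          linarith
        have h2 := mul_le_mul_of_nonneg_right (hbound α hα m (hn.trans hm)) h3
        have h4 := norm_sub_le_norm_sub_add_norm_sub (risingCoeffNormalized α n)
          (risingCoeffNormalized α m) (risingCoeffNormalized α (m + 1))
        rw [norm_sub_rev (risingCoeffNormalized α m)] at h4
        push_cast
        linarith
    have hlim := (tendsto_const_nhds (x := risingCoeffNormalized α n)).sub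
      (tendsto_risingCoeffNormalized α)
    refine le_of_tendsto hlim.norm ?_
    filter_upwards [eventually_ge_atTop n] with m hm
    refine (htel m hm).trans ?_
    have h5 : (0 : ℝ) ≤ 1 / m := by positivity
    have h6 : (0 : ℝ) ≤ 1 / n := by positivity
    nlinarith [mul_nonneg hUD h5, mul_nonneg hU0 h6]

end RisingCoeff

end WeightedPerm

/-! ### Geometry of `Δ₀` and a global error bound for class `𝓕` -/

namespace WeightedPerm

section ClassF

/-- Since `cos (arg u) = Re u / |u|`, an upper bound on this ratio below `cos φ` keeps `|arg u|`
above `φ`. -/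
theorem mem_Delta0_of_re_le {r R φ κ : ℝ} (hφ : φ < Real.pi / 2) (hκ : κ < Real.cos φ) {z : ℂ}
    (hzR : ‖z‖ < R) (hzr : z ≠ (r : ℂ)) (hre : (z - r).re ≤ κ * ‖z - r‖) : z ∈ Delta0 r R φ := by
  refine ⟨hzR, hzr, ?_⟩
  by_contra! harg
  have h0 : z - r ≠ 0 := sub_ne_zero.2 hzr
  have hn : 0 < ‖z - r‖ := norm_pos_iff.2 h0
  have h1 := Real.cos_le_cos_of_nonneg_of_le_pi (abs_nonneg (Complex.arg (z - r)))
    (by linarith [Real.pi_pos]) harg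
  rw [Real.cos_abs, Complex.cos_arg h0, le_div_iff₀ hn] at h1
  nlinarith

theorem one_sub_mem_slitPlane_of_re_le {κ : ℝ} (hκ : κ < 1) {z : ℂ} (hz : z ≠ 1)
    (hre : (z - 1).re ≤ κ * ‖z - 1‖) : 1 - z ∈ Complex.slitPlane := by
  rw [Complex.mem_slitPlane_iff]
  by_contra! h
  have him : (z - 1).im = 0 := by
    have := h.2
    simp only [Complex.sub_im, Complex.one_im] at this ⊢
    linarith
  have hre0 : 0 ≤ (z - 1).re := by
    have := h.1
    simp only [Complex.sub_re, Complex.one_re] at this ⊢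
    linarith
  have hn : ‖z - 1‖ = (z - 1).re := by
    have : z - 1 = (((z - 1).re : ℝ) : ℂ) := Complex.ext rfl (by simpa using him)
    rw [this, Complex.norm_real, Real.norm_of_nonneg (by simpa using hre0)]
    simp
  have hpos : 0 < ‖z - 1‖ := norm_pos_iff.2 (sub_ne_zero.2 hz)
  rw [← hn] at hre
  nlinarith

/-- The disc is small relative to `|1 - t|`, so it meets the outside of the unit disc only within a
wide-open sector: `Re (z - 1) ≤ |z - t| ≤ c |1 - t| ≤ 2c |1 - z|`. -/
theorem near_disc {c : ℝ} (hc0 : 0 < c) (hc : c ≤ 1 / 4) {t z : ℂ} (ht : ‖t‖ < 1)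
    (hz : z ∈ Metric.closedBall t (c * ‖1 - t‖)) :
    ‖z‖ ≤ 1 + 2 * c ∧ z ≠ 1 ∧ (z - 1).re ≤ 2 * c * ‖z - 1‖ ∧
      ‖1 - t‖ / 2 ≤ ‖1 - z‖ ∧ ‖1 - z‖ ≤ 2 * ‖1 - t‖ := by
  rw [mem_closedBall_iff_norm] at hz
  have hpos : 0 < ‖1 - t‖ := by
    rw [norm_pos_iff]
    intro h
    rw [← sub_eq_zero.1 h, norm_one] at ht
    linarith
  have h2 : ‖1 - t‖ ≤ 2 := by
    have := norm_sub_le 1 t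
    rw [norm_one] at this
    linarith
  have hlow : (1 - c) * ‖1 - t‖ ≤ ‖1 - z‖ := by
    have := norm_sub_le_norm_sub_add_norm_sub 1 z t
    linarith
  have hup : ‖1 - z‖ ≤ (1 + c) * ‖1 - t‖ := by
    have := norm_sub_le_norm_sub_add_norm_sub 1 t z
    rw [norm_sub_rev t z] at this
    linarith
  refine ⟨?_, ?_, ?_, by nlinarith, by nlinarith⟩
  · have := norm_le_norm_add_norm_sub' z t
    nlinarith
  · rintro rfl
    rw [sub_self, norm_zero] at hlow
    nlinarith
  · have h3 : (z - 1).re ≤ ‖z - t‖ := by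
      have h4 := Complex.re_le_norm (z - t)
      have h5 := Complex.re_le_norm t
      simp only [Complex.sub_re, Complex.one_re] at h4 ⊢
      linarith
    rw [norm_sub_rev z 1]
    nlinarith

/-- Rescales to `r = 1` and upgrades the local `O(t - r)` to one linear bound on all the discs: the
hypothesis serves near `r`, compactness elsewhere. -/
theorem IsClassF.exists_bound {G : PowerSeries ℂ} {r θ : ℝ} {K : ℂ} (hG : IsClassF G r θ K) :
    ∃ (c E : ℝ) (g : ℂ → ℂ), 0 < c ∧ c ≤ 1 / 4 ∧ 0 ≤ E ∧
      (∀ t : ℂ, ‖t‖ < 1 → HasSum (fun n : ℕ => PowerSeries.coeff n G * (r : ℂ) ^ n * t ^ n)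
        (g t)) ∧
      ∀ t : ℂ, ‖t‖ < 1 → DifferentiableOn ℂ g (Metric.closedBall t (c * ‖1 - t‖)) ∧
        ∀ z ∈ Metric.closedBall t (c * ‖1 - t‖), 1 - z ∈ Complex.slitPlane ∧
          ‖g z - ((θ : ℂ) * -Complex.log (1 - z) + K)‖ ≤ E * ‖1 - z‖ := by
  obtain ⟨hr, -, R, φ, hrR, hφ0, hφ, g, hgd, hgs, hgO⟩ := hG
  have hr0 : (r : ℂ) ≠ 0 := by exact_mod_cast hr.ne'
  have hcos : 0 < Real.cos φ := Real.cos_pos_of_mem_Ioo ⟨by linarith, hφ⟩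
  obtain ⟨c, hc0, hc4, hcR, hcφ⟩ : ∃ c : ℝ, 0 < c ∧ c ≤ 1 / 4 ∧ r * (1 + 2 * c) < R ∧
      2 * c < Real.cos φ := by
    -- The three terms serve `near_disc`, the radius `R` and the angle `φ` in turn.
    refine ⟨min (1 / 4) (min ((R - r) / (4 * r)) (Real.cos φ / 4)), ?_, min_le_left _ _, ?_, ?_⟩
    · have : 0 < (R - r) / (4 * r) := div_pos (by linarith) (by linarith)
      positivity
    · have h1 : min (1 / 4) (min ((R - r) / (4 * r)) (Real.cos φ / 4)) ≤ (R - r) / (4 * r) :=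
        (min_le_right _ _).trans (min_le_left _ _)
      rw [le_div_iff₀ (by linarith)] at h1
      nlinarith
    · have h1 : min (1 / 4) (min ((R - r) / (4 * r)) (Real.cos φ / 4)) ≤ Real.cos φ / 4 :=
        (min_le_right _ _).trans (min_le_right _ _)
      linarith
  set e : ℂ → ℂ := fun t => g t - ((θ : ℂ) * Complex.log (1 / (1 - t / (r : ℂ))) + K) with he
  have hslit : ∀ z : ℂ, z ≠ r → (z - r).re ≤ 2 * c * ‖z - r‖ →
      1 - z / r ∈ Complex.slitPlane := by
    intro z hz hre
    have h1 : z / r - 1 = (((1 / r : ℝ)) : ℂ) * (z - r) := by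
      push_cast
      field_simp
    refine one_sub_mem_slitPlane_of_re_le (κ := 2 * c) (by linarith) ?_ ?_
    · intro h
      rw [div_eq_one_iff_eq hr0] at h
      exact hz h
    · rw [h1, Complex.re_ofReal_mul, norm_mul, Complex.norm_real,
        Real.norm_of_nonneg (by positivity)]
      have : 0 < 1 / r := by positivity
      nlinarith
  obtain ⟨E, hE0, hE⟩ : ∃ E : ℝ, 0 ≤ E ∧ ∀ z : ℂ, ‖z‖ ≤ r * (1 + 2 * c) → z ≠ r →
      (z - r).re ≤ 2 * c * ‖z - r‖ → ‖e z‖ ≤ E * ‖z - r‖ := by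
    obtain ⟨C, hC⟩ := hgO.bound
    rw [eventually_nhdsWithin_iff, Metric.eventually_nhds_iff] at hC
    obtain ⟨δ, hδ, hC⟩ := hC
    -- On this compact set the error is continuous, hence bounded by some `B`, and `B ≤ (B/δ) |z -
    -- r|` because `|z - r| ≥ δ`.
    set T : Set ℂ := {z | ‖z‖ ≤ r * (1 + 2 * c) ∧ (z - r).re ≤ 2 * c * ‖z - r‖ ∧
      δ ≤ ‖z - r‖} with hT
    have hTc : IsCompact T := by
      refine Metric.isCompact_of_isClosed_isBounded ?_ ?_
      · have h1 : IsClosed {z : ℂ | ‖z‖ ≤ r * (1 + 2 * c)} :=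
          isClosed_le continuous_norm continuous_const
        have h2 : IsClosed {z : ℂ | (z - r).re ≤ 2 * c * ‖z - r‖} :=
          isClosed_le (Complex.continuous_re.comp (by fun_prop)) (by fun_prop)
        have h3 : IsClosed {z : ℂ | δ ≤ ‖z - r‖} := isClosed_le continuous_const (by fun_prop)
        exact h1.inter (h2.inter h3)
      · exact (Metric.isBounded_closedBall (x := (0 : ℂ)) (r := r * (1 + 2 * c))).subset
          fun z hz => by simpa using hz.1
    have hTne : ∀ z ∈ T, z ≠ r := by
      rintro z hz rfl
      have := hz.2.2
      rw [sub_self, norm_zero] at this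
      linarith
    have hTD : T ⊆ Delta0 r R φ := fun z hz =>
      mem_Delta0_of_re_le hφ hcφ (hz.1.trans_lt hcR) (hTne z hz) hz.2.1
    have hec : ContinuousOn e T := by
      refine (hgd.continuousOn.mono hTD).sub (((continuousOn_const).mul ?_).add continuousOn_const)
      have h1 : ContinuousOn (fun z : ℂ => -Complex.log (1 - z / r)) T :=
        (ContinuousOn.clog (by fun_prop) fun z hz => hslit z (hTne z hz) hz.2.1).neg
      refine h1.congr fun z hz => ?_
      rw [one_div, Complex.log_inv _ (Complex.slitPlane_arg_ne_pi (hslit z (hTne z hz) hz.2.1))]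
    obtain ⟨B, hB⟩ := hTc.exists_bound_of_continuousOn hec
    refine ⟨max (max C (B / δ)) 0, le_max_right _ _, fun z hz1 hz2 hz3 => ?_⟩
    by_cases hzδ : δ ≤ ‖z - r‖
    · have h1 := hB z ⟨hz1, hz3, hzδ⟩
      have hB0 : 0 ≤ B := (norm_nonneg _).trans h1
      calc ‖e z‖ ≤ B := h1
        _ = B / δ * δ := by field_simp
        _ ≤ B / δ * ‖z - r‖ := mul_le_mul_of_nonneg_left hzδ (by positivity)
        _ ≤ _ := mul_le_mul_of_nonneg_right ((le_max_right _ _).trans (le_max_left _ _))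
          (norm_nonneg _)
    · have hzD := mem_Delta0_of_re_le hφ hcφ (hz1.trans_lt hcR) hz2 hz3
      have h1 := hC (by rw [dist_eq_norm]; linarith) hzD
      exact h1.trans (mul_le_mul_of_nonneg_right ((le_max_left _ _).trans (le_max_left _ _))
          (norm_nonneg _))
  have hscale : ∀ t : ℂ, ‖t‖ < 1 → ∀ z ∈ Metric.closedBall t (c * ‖1 - t‖),
      ‖(r : ℂ) * z‖ ≤ r * (1 + 2 * c) ∧ (r : ℂ) * z ≠ r ∧
        ((r : ℂ) * z - r).re ≤ 2 * c * ‖(r : ℂ) * z - r‖ := by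
    intro t ht z hz
    obtain ⟨h1, h2, h3, -, -⟩ := near_disc hc0 hc4 ht hz
    have h4 : (r : ℂ) * z - r = r * (z - 1) := by ring
    rw [h4, Complex.re_ofReal_mul, norm_mul, norm_mul, Complex.norm_real,
      Real.norm_of_nonneg hr.le]
    refine ⟨mul_le_mul_of_nonneg_left h1 hr.le, fun h => h2 ?_, by nlinarith⟩
    exact mul_left_cancel₀ hr0 (by rw [h, mul_one])
  refine ⟨c, E * r, fun t => g (r * t), hc0, hc4, by positivity, fun t ht => ?_, fun t ht =>
    ⟨?_, fun z hz => ?_⟩⟩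
  · have h1 : ‖(r : ℂ) * t‖ < r := by
      rw [norm_mul, Complex.norm_real, Real.norm_of_nonneg hr.le]
      nlinarith
    simpa only [mul_pow, mul_assoc] using hgs _ h1
  · refine hgd.comp (by fun_prop) fun z hz => ?_
    obtain ⟨h1, h2, h3⟩ := hscale t ht z hz
    exact mem_Delta0_of_re_le hφ hcφ (h1.trans_lt hcR) h2 h3
  · obtain ⟨h1, h2, h3⟩ := hscale t ht z hz
    have h4 := hslit _ h2 h3
    have h5 := hE _ h1 h2 h3
    rw [mul_div_cancel_left₀ _ hr0] at h4
    refine ⟨h4, ?_⟩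
    have h6 : (r : ℂ) * z - r = r * (z - 1) := by ring
    simp only [he] at h5
    rw [mul_div_cancel_left₀ _ hr0, one_div, Complex.log_inv _
      (Complex.slitPlane_arg_ne_pi h4), h6, norm_mul, Complex.norm_real,
      Real.norm_of_nonneg hr.le, ← mul_assoc, norm_sub_rev z 1] at h5
    exact h5

end ClassF

end WeightedPerm

/-! ### Coefficient asymptotics in class `𝓕` -/

namespace WeightedPerm

section ClassFCoeff

theorem rpow_le_two_rpow_mul_rpow {x y p b : ℝ} (hy : 0 < y) (h1 : y / 2 ≤ x) (h2 : x ≤ 2 * y)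
    (hp : |p| ≤ b) : x ^ p ≤ 2 ^ b * y ^ p := by
  have hx : 0 < x := by linarith
  have hxy : 0 < x / y := by positivity
  have h3 : (x / y) ^ p ≤ 2 ^ b := by
    rcases le_total 0 p with h | h
    · calc (x / y) ^ p ≤ 2 ^ p := Real.rpow_le_rpow hxy.le (by rwa [div_le_iff₀ hy]) h
        _ ≤ 2 ^ b := Real.rpow_le_rpow_of_exponent_le (by norm_num) ((le_abs_self p).trans hp)
    · calc (x / y) ^ p ≤ (2⁻¹ : ℝ) ^ p := Real.rpow_le_rpow_of_nonpos (by norm_num)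
            (by rw [le_div_iff₀ hy]; linarith) h
        _ = 2 ^ (-p) := by rw [Real.inv_rpow (by norm_num), Real.rpow_neg (by norm_num)]
        _ ≤ 2 ^ b := Real.rpow_le_rpow_of_exponent_le (by norm_num) ((neg_le_abs p).trans hp)
  rwa [Real.div_rpow hx.le hy.le, div_le_iff₀ (by positivity)] at h3

/-- The modulus is `|u|^{-θ Re w} e^{θ Im w · arg u}`, and `|arg u| ≤ π`. -/
theorem norm_exp_neg_log_le {u w : ℂ} (hu : u ≠ 0) (hw : ‖w‖ ≤ 1) {θ : ℝ} (hθ : 0 ≤ θ) :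
    ‖Complex.exp (w * (θ * -Complex.log u))‖ ≤
      Real.exp (θ * Real.pi) * ‖u‖ ^ (-(θ * w.re)) := by
  have hpos : 0 < ‖u‖ := norm_pos_iff.2 hu
  rw [Complex.norm_exp, Real.rpow_def_of_pos hpos, ← Real.exp_add, Real.exp_le_exp]
  have h1 : (w * (θ * -Complex.log u)).re =
      Real.log ‖u‖ * -(θ * w.re) + θ * (w.im * (Complex.log u).im) := by
    rw [Complex.mul_re, Complex.re_ofReal_mul, Complex.im_ofReal_mul, Complex.neg_re,
      Complex.neg_im, Complex.log_re]
    ring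
  have h2 : w.im * (Complex.log u).im ≤ Real.pi := by
    refine (le_abs_self _).trans ?_
    rw [abs_mul]
    have h3 : |w.im| ≤ 1 := (Complex.abs_im_le_norm w).trans hw
    have h4 : |(Complex.log u).im| ≤ Real.pi := by
      rw [Complex.log_im]
      exact Complex.abs_arg_le_pi u
    nlinarith [abs_nonneg w.im, abs_nonneg (Complex.log u).im]
  rw [h1]
  nlinarith

theorem coeff_exp_subst_rescale {G : PowerSeries ℂ} (hG : PowerSeries.constantCoeff G = 0)
    (r w : ℂ) (n : ℕ) :
    PowerSeries.coeff n ((PowerSeries.exp ℂ).subst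
      (PowerSeries.mk fun k => w * (PowerSeries.coeff k G * r ^ k))) =
      r ^ n * PowerSeries.coeff n ((PowerSeries.exp ℂ).subst (w • G)) := by
  have h1 : (PowerSeries.mk fun k => w * (PowerSeries.coeff k G * r ^ k)) =
      PowerSeries.rescale r (w • G) := by
    ext k
    rw [PowerSeries.coeff_mk, PowerSeries.coeff_rescale, PowerSeries.coeff_smul, smul_eq_mul]
    ring
  have h2 : PowerSeries.constantCoeff (w • G) = 0 := by simp [hG]
  have h3 : PowerSeries.constantCoeff (PowerSeries.rescale r (w • G)) = 0 := by
    rw [← PowerSeries.coeff_zero_eq_constantCoeff_apply, PowerSeries.coeff_rescale,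
      PowerSeries.coeff_zero_eq_constantCoeff_apply, h2, mul_zero]
  rw [h1, coeff_exp_subst h3, coeff_exp_subst h2, Finset.mul_sum]
  refine Finset.sum_congr rfl fun d _ => ?_
  rw [← map_pow, PowerSeries.coeff_rescale]
  ring

/-- With `e` the error in the expansion of `g`, the difference from the model is `e^{wK} (1 -
t)^{-wθ} (exp(w e) - 1)`, of order `|1 - t|^{1 - θ Re w}`; the transfer lemma applies with `a = 1 -
θ Re w`. -/
theorem IsClassF.exists_coeff_bound {G : PowerSeries ℂ} {r θ : ℝ} {K : ℂ}
    (hG : IsClassF G r θ K) (hG0 : PowerSeries.constantCoeff G = 0) :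
    ∃ C : ℝ, 0 ≤ C ∧ ∃ n₀ : ℕ, ∀ n : ℕ, n₀ ≤ n → ∀ w : ℂ, ‖w‖ = 1 →
      ‖(r : ℂ) ^ n * PowerSeries.coeff n ((PowerSeries.exp ℂ).subst (w • G)) -
        Complex.exp (w * K) * risingCoeff (w * θ) n‖ ≤ C * (n : ℝ) ^ (θ * w.re - 2) := by
  have hθ := hG.2.1
  obtain ⟨c, E, g, hc0, hc4, hE, hgs, hg⟩ := hG.exists_bound
  -- One order of differentiation must serve every `w`: `a ≤ 1 + θ`, and the transfer lemma needs `a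
  -- + 2 ≤ k`.
  set k : ℕ := ⌈θ⌉₊ + 3 with hk
  have hkθ : θ + 3 ≤ k := by
    rw [hk]
    push_cast
    linarith [Nat.le_ceil θ]
  obtain ⟨C, hC, htr⟩ := norm_coeff_le_of_bound_near_disc hc0 k
  set M : ℝ := Real.exp ‖K‖ * Real.exp (θ * Real.pi) * (E * Real.exp (4 * E)) *
    2 ^ (1 + θ) with hM
  refine ⟨C * M, by positivity, k + 1, fun n hn w hw => ?_⟩
  have hwre : |w.re| ≤ 1 := hw ▸ Complex.abs_re_le_norm w
  have hρ : |1 - θ * w.re| ≤ 1 + θ := by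
    refine (abs_sub _ _).trans ?_
    rw [abs_one, abs_mul, abs_of_nonneg hθ]
    nlinarith
  set L : ℂ → ℂ := fun t => w * (θ * -Complex.log (1 - t)) with hL
  set F : ℂ → ℂ := fun t => Complex.exp (w * g t) - Complex.exp (w * K) * Complex.exp (L t)
    with hF
  have hgs' : ∀ t : ℂ, ‖t‖ < 1 → HasSum
      (fun n : ℕ => w * (PowerSeries.coeff n G * (r : ℂ) ^ n) * t ^ n) (w * g t) := by
    intro t ht
    simpa only [mul_assoc] using (hgs t ht).mul_left w
  have hLs : ∀ t : ℂ, ‖t‖ < 1 → HasSum (fun n : ℕ => w * θ / (n : ℂ) * t ^ n) (L t) := by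
    intro t ht
    have := (Complex.hasSum_taylorSeries_neg_log ht).mul_left (w * θ)
    simp only [hL, ← mul_assoc]
    refine this.congr_fun fun n => ?_
    ring
  have hgd := differentiableOn_of_hasSum hgs'
  have hLd := differentiableOn_of_hasSum hLs
  have hnhds : Metric.ball (0 : ℂ) 1 ∈ 𝓝 0 := Metric.ball_mem_nhds 0 one_pos
  have hFd : DifferentiableOn ℂ F (Metric.ball 0 1) :=
    hgd.cexp.sub (hLd.cexp.const_mul _)
  have hcoeff : iteratedDeriv n F 0 / (n.factorial : ℂ) =
      (r : ℂ) ^ n * PowerSeries.coeff n ((PowerSeries.exp ℂ).subst (w • G)) -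
        Complex.exp (w * K) * risingCoeff (w * θ) n := by
    have h1 : ContDiffAt ℂ n (fun t => Complex.exp (w * g t)) 0 :=
      (hgd.cexp.analyticAt hnhds).contDiffAt
    have h2 : ContDiffAt ℂ n (fun t => Complex.exp (w * K) * Complex.exp (L t)) 0 :=
      ((hLd.cexp.const_mul _).analyticAt hnhds).contDiffAt
    rw [hF, iteratedDeriv_fun_sub h1 h2, iteratedDeriv_const_mul_field, sub_div, mul_div_assoc,
      ← coeff_exp_subst_eq_iteratedDeriv (by simp [hG0]) hgs',
      ← coeff_exp_subst_eq_iteratedDeriv (by simp) hLs, ← mk_risingCoeff, PowerSeries.coeff_mk,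
      coeff_exp_subst_rescale hG0]
  rw [← hcoeff, show θ * w.re - 2 = -(1 - θ * w.re) - 1 by ring]
  refine htr F M (1 - θ * w.re) (by positivity) ?_ (by lia) hFd (fun t ht => ⟨?_, fun z hz => ?_⟩)
    n (by lia)
  · have := (abs_le.1 hρ).2
    linarith
  · refine ((hg t ht).1.const_mul w).cexp.sub (DifferentiableOn.const_mul ?_ _)
    refine (DifferentiableOn.const_mul (DifferentiableOn.const_mul ?_ _) _).cexp
    exact (DifferentiableOn.clog (by fun_prop) fun z hz => ((hg t ht).2 z hz).1).neg
  · replace hz := Metric.sphere_subset_closedBall hz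
    obtain ⟨hsl, hgz⟩ := (hg t ht).2 z hz
    obtain ⟨h1, h2, -, h4, h5⟩ := near_disc hc0 hc4 ht hz
    have hz0 : 1 - z ≠ 0 := sub_ne_zero.2 h2.symm
    have hzpos : 0 < ‖1 - z‖ := norm_pos_iff.2 hz0
    have hz4 : ‖1 - z‖ ≤ 4 := by
      have := norm_sub_le 1 z
      rw [norm_one] at this
      linarith
    set e : ℂ := g z - ((θ : ℂ) * -Complex.log (1 - z) + K) with he
    have hFz : F z = Complex.exp (w * K) * Complex.exp (L z) * (Complex.exp (w * e) - 1) := by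
      have : w * g z = w * K + L z + w * e := by
        rw [he, hL]
        ring
      rw [hF]
      simp only
      rw [this, Complex.exp_add, Complex.exp_add]
      ring
    have hwe : ‖w * e‖ ≤ E * ‖1 - z‖ := by rwa [norm_mul, hw, one_mul]
    have h6 : ‖Complex.exp (w * e) - 1‖ ≤ E * ‖1 - z‖ * Real.exp (4 * E) := by
      have h7 := Complex.norm_exp_sub_sum_le_norm_mul_exp (w * e) 1
      simp only [Finset.sum_range_one, pow_zero, Nat.factorial_zero, Nat.cast_one, div_one,
        pow_one] at h7
      refine h7.trans (mul_le_mul hwe (Real.exp_le_exp.2 (hwe.trans ?_)) (by positivity)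
        (by positivity))
      nlinarith
    have h7 : ‖Complex.exp (w * K)‖ ≤ Real.exp ‖K‖ := by
      refine (Complex.norm_exp_le_exp_norm _).trans (le_of_eq ?_)
      rw [norm_mul, hw, one_mul]
    have h8 := norm_exp_neg_log_le hz0 hw.le hθ
    have htpos : 0 < ‖1 - t‖ := by linarith
    have h9 := rpow_le_two_rpow_mul_rpow htpos h4 h5 hρ
    have h10 : ‖1 - z‖ ^ (-(θ * w.re)) * ‖1 - z‖ = ‖1 - z‖ ^ (1 - θ * w.re) := by
      nth_rewrite 2 [← Real.rpow_one ‖1 - z‖]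
      rw [← Real.rpow_add hzpos]
      congr 1
      ring
    rw [hFz, norm_mul, norm_mul]
    calc _ ≤ Real.exp ‖K‖ * (Real.exp (θ * Real.pi) * ‖1 - z‖ ^ (-(θ * w.re))) *
          (E * ‖1 - z‖ * Real.exp (4 * E)) := by
          gcongr
      _ = Real.exp ‖K‖ * Real.exp (θ * Real.pi) * (E * Real.exp (4 * E)) *
          (‖1 - z‖ ^ (-(θ * w.re)) * ‖1 - z‖) := by ring
      _ ≤ Real.exp ‖K‖ * Real.exp (θ * Real.pi) * (E * Real.exp (4 * E)) *
          (2 ^ (1 + θ) * ‖1 - t‖ ^ (1 - θ * w.re)) := by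
          rw [h10]
          gcongr
      _ = _ := by rw [hM]; ring

end ClassFCoeff

end WeightedPerm

/-! ### Convolution estimates for the weight `(n + 1)^{-1-γ}` -/

namespace WeightedPerm

section Convolution

/-- Follows from `(1 - 1/x)^{-γ} ≥ 1 + γ/x`; it bounds tails of `∑ k^{-1-γ}` by telescoping. -/
theorem mul_rpow_le_sub_rpow {γ : ℝ} (hγ : 0 < γ) {x : ℝ} (hx : 1 < x) :
    γ * x ^ (-1 - γ) ≤ (x - 1) ^ (-γ) - x ^ (-γ) := by
  have hx0 : 0 < x := by linarith
  have hu : 0 < 1 - 1 / x := by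
    rw [sub_pos, div_lt_one hx0]
    exact hx
  have h1 : (x - 1) ^ (-γ) = x ^ (-γ) * (1 - 1 / x) ^ (-γ) := by
    rw [← Real.mul_rpow hx0.le hu.le]
    congr 1
    field_simp
  have h2 : 1 + γ * (1 / x) ≤ (1 - 1 / x) ^ (-γ) := by
    rw [Real.rpow_def_of_pos hu]
    have h3 := Real.log_le_sub_one_of_pos hu
    have h4 := Real.add_one_le_exp (γ * (1 / x))
    have h5 : Real.exp (γ * (1 / x)) ≤ Real.exp (Real.log (1 - 1 / x) * -γ) :=
      Real.exp_le_exp.2 (by nlinarith)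
    linarith
  have h3 : x ^ (-1 - γ) = x ^ (-γ) * (1 / x) := by
    rw [sub_eq_add_neg, add_comm, Real.rpow_add hx0, Real.rpow_neg_one, one_div]
  rw [h1, h3]
  nlinarith [Real.rpow_pos_of_pos hx0 (-γ)]

theorem sum_range_rpow_le {γ : ℝ} (hγ : 0 < γ) {m : ℕ} (hm : 1 ≤ m) (N : ℕ) :
    ∑ k ∈ Finset.range N, ((k + m : ℕ) + 1 : ℝ) ^ (-1 - γ) ≤ γ⁻¹ * (m : ℝ) ^ (-γ) := by
  have hm0 : (1 : ℝ) ≤ m := by exact_mod_cast hm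
  have h : ∀ N : ℕ, γ * ∑ k ∈ Finset.range N, ((k + m : ℕ) + 1 : ℝ) ^ (-1 - γ) ≤
      (m : ℝ) ^ (-γ) - ((N + m : ℕ) : ℝ) ^ (-γ) := by
    intro N
    induction N with
    | zero => simp
    | succ N ih =>
      rw [Finset.sum_range_succ, mul_add]
      have h1 : (1 : ℝ) < ((N + m : ℕ) + 1 : ℝ) := by
        push_cast
        have : (0 : ℝ) ≤ N := Nat.cast_nonneg N
        linarith
      have h2 := mul_rpow_le_sub_rpow hγ h1
      rw [add_sub_cancel_right] at h2
      have h3 : ((N + 1 + m : ℕ) : ℝ) = ((N + m : ℕ) + 1 : ℝ) := by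
        push_cast
        ring
      rw [h3]
      linarith
  rw [inv_mul_eq_div, le_div_iff₀ hγ, mul_comm]
  exact (h N).trans (sub_le_self _ (by positivity))

theorem summable_weight {γ : ℝ} (hγ : 0 < γ) :
    Summable fun k : ℕ => ((k : ℝ) + 1) ^ (-1 - γ) := by
  have h := (summable_nat_add_iff 1).2
    (Real.summable_nat_rpow.2 (show -1 - γ < -1 by linarith))
  simpa using h

theorem norm_sub_sum_le {γ : ℝ} (hγ : 0 < γ) {d : ℕ → ℂ} {S : ℂ} {D : ℝ} (hS : HasSum d S)
    (hd : ∀ k : ℕ, ‖d k‖ ≤ D * ((k : ℝ) + 1) ^ (-1 - γ)) {m : ℕ} (hm : 1 ≤ m) :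
    ‖S - ∑ k ∈ Finset.range m, d k‖ ≤ D * (γ⁻¹ * (m : ℝ) ^ (-γ)) := by
  have hD : 0 ≤ D := by
    have := (norm_nonneg _).trans (hd 0)
    simpa using this
  have h1 : HasSum (fun k => d (k + m)) (S - ∑ k ∈ Finset.range m, d k) :=
    (hasSum_nat_add_iff' m).2 hS
  refine le_of_tendsto h1.tendsto_sum_nat.norm (Eventually.of_forall fun N => ?_)
  refine (norm_sum_le _ _).trans ?_
  refine (Finset.sum_le_sum fun k _ => hd (k + m)).trans ?_
  rw [← Finset.mul_sum]
  exact mul_le_mul_of_nonneg_left (sum_range_rpow_le hγ hm N) hD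

/-- One of the two indices is at least `n/2`, so its weight is comparable to that of `n`, and the
other weight is summable. Hence sequences dominated by this weight form an algebra under
convolution. -/
theorem exists_sum_weight_mul_weight_le {γ : ℝ} (hγ : 0 < γ) :
    ∃ C : ℝ, 0 ≤ C ∧ ∀ n : ℕ, ∑ p ∈ Finset.HasAntidiagonal.antidiagonal n,
      ((p.1 : ℝ) + 1) ^ (-1 - γ) * ((p.2 : ℝ) + 1) ^ (-1 - γ) ≤
        C * ((n : ℝ) + 1) ^ (-1 - γ) := by
  set v : ℕ → ℝ := fun k => ((k : ℝ) + 1) ^ (-1 - γ) with hv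
  have hv0 : ∀ k, 0 ≤ v k := fun k => by positivity
  have hvs : Summable v := summable_weight hγ
  have hhalf : ∀ i n : ℕ, n + 1 ≤ 2 * (i + 1) → v i ≤ 2 ^ (1 + γ) * v n := by
    intro i n hin
    have h1 : ((n : ℝ) + 1) / 2 ≤ (i : ℝ) + 1 := by
      have : ((n + 1 : ℕ) : ℝ) ≤ ((2 * (i + 1) : ℕ) : ℝ) := by exact_mod_cast hin
      push_cast at this
      linarith
    calc v i ≤ (((n : ℝ) + 1) / 2) ^ (-1 - γ) :=
          Real.rpow_le_rpow_of_nonpos (by positivity) h1 (by linarith)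
      _ = 2 ^ (1 + γ) * v n := by
          rw [Real.div_rpow (by positivity) (by norm_num), show -1 - γ = -(1 + γ) by ring,
            Real.rpow_neg (by norm_num : (0 : ℝ) ≤ 2), hv]
          simp only
          rw [show -1 - γ = -(1 + γ) by ring]
          field_simp
  refine ⟨2 ^ (1 + γ) * (2 * ∑' k, v k), by
    have : 0 ≤ ∑' k, v k := tsum_nonneg hv0
    positivity, fun n => ?_⟩
  have hterm : ∀ p ∈ Finset.HasAntidiagonal.antidiagonal n,
      v p.1 * v p.2 ≤ 2 ^ (1 + γ) * v n * (v p.1 + v p.2) := by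
    intro p hp
    have hpn : p.1 + p.2 = n := Finset.HasAntidiagonal.mem_antidiagonal.1 hp
    have hw : 0 ≤ 2 ^ (1 + γ) * v n := mul_nonneg (by positivity) (hv0 n)
    rcases le_total p.1 p.2 with h | h
    · nlinarith [hhalf p.2 n (by lia), hv0 p.1, hv0 p.2, mul_nonneg hw (hv0 p.2),
        mul_le_mul_of_nonneg_left (hhalf p.2 n (by lia)) (hv0 p.1)]
    · nlinarith [hhalf p.1 n (by lia), hv0 p.1, hv0 p.2, mul_nonneg hw (hv0 p.1),
        mul_le_mul_of_nonneg_right (hhalf p.1 n (by lia)) (hv0 p.2)]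
  have h1 : ∑ p ∈ Finset.HasAntidiagonal.antidiagonal n, v p.1 ≤ ∑' k, v k := by
    rw [Finset.Nat.sum_antidiagonal_eq_sum_range_succ_mk]
    exact hvs.sum_le_tsum _ fun k _ => hv0 k
  have h2 : ∑ p ∈ Finset.HasAntidiagonal.antidiagonal n, v p.2 ≤ ∑' k, v k := by
    rw [Finset.Nat.sum_antidiagonal_eq_sum_range_succ_mk] at h1 ⊢
    refine le_trans (le_of_eq ?_) h1
    simpa using Finset.sum_range_reflect v (n + 1)
  calc _ ≤ ∑ p ∈ Finset.HasAntidiagonal.antidiagonal n,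
        2 ^ (1 + γ) * v n * (v p.1 + v p.2) := Finset.sum_le_sum hterm
    _ ≤ 2 ^ (1 + γ) * v n * (2 * ∑' k, v k) := by
        rw [← Finset.mul_sum, Finset.sum_add_distrib]
        exact mul_le_mul_of_nonneg_left (by linarith) (mul_nonneg (by positivity) (hv0 n))
    _ = _ := by ring

/-- In that algebra the `d`-th power has bound `(M C)^d`, and the exponential series sums these to
`exp (M C)`. -/
theorem exists_exp_subst_coeff_le {γ : ℝ} (hγ : 0 < γ) (M : ℝ) :
    ∃ D : ℝ, 0 ≤ D ∧ ∀ β : ℕ → ℂ, β 0 = 0 →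
      (∀ k : ℕ, ‖β k‖ ≤ M * ((k : ℝ) + 1) ^ (-1 - γ)) → ∀ n : ℕ,
      ‖PowerSeries.coeff n ((PowerSeries.exp ℂ).subst (PowerSeries.mk β))‖ ≤
        D * ((n : ℝ) + 1) ^ (-1 - γ) := by
  obtain ⟨C, hC, hconv⟩ := exists_sum_weight_mul_weight_le hγ
  refine ⟨Real.exp (M * C), by positivity, fun β hβ0 hβ n => ?_⟩
  have hM : 0 ≤ M := by
    have := (norm_nonneg _).trans (hβ 0)
    simpa using this
  have hpow : ∀ d n : ℕ, ‖PowerSeries.coeff n (PowerSeries.mk β ^ d)‖ ≤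
      (M * C) ^ d * ((n : ℝ) + 1) ^ (-1 - γ) := by
    intro d
    induction d with
    | zero =>
      intro n
      rw [pow_zero, pow_zero, one_mul, PowerSeries.coeff_one]
      split_ifs with h
      · simp [h]
      · rw [norm_zero]
        positivity
    | succ d ih =>
      intro n
      rw [pow_succ, PowerSeries.coeff_mul]
      calc _ ≤ ∑ p ∈ Finset.HasAntidiagonal.antidiagonal n,
            ‖PowerSeries.coeff p.1 (PowerSeries.mk β ^ d) *
              PowerSeries.coeff p.2 (PowerSeries.mk β)‖ := norm_sum_le _ _
        _ ≤ ∑ p ∈ Finset.HasAntidiagonal.antidiagonal n, (M * C) ^ d * M *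
            (((p.1 : ℝ) + 1) ^ (-1 - γ) * ((p.2 : ℝ) + 1) ^ (-1 - γ)) := by
            refine Finset.sum_le_sum fun p _ => ?_
            rw [norm_mul, PowerSeries.coeff_mk]
            calc _ ≤ _ := mul_le_mul (ih p.1) (hβ p.2) (norm_nonneg _) (by positivity)
              _ = _ := by ring
        _ ≤ (M * C) ^ d * M * (C * ((n : ℝ) + 1) ^ (-1 - γ)) := by
            rw [← Finset.mul_sum]
            exact mul_le_mul_of_nonneg_left (hconv n) (by positivity)
        _ = _ := by ring
  rw [coeff_exp_subst (by simpa using hβ0)]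
  calc _ ≤ ∑ d ∈ Finset.range (n + 1), ‖(1 / (d.factorial : ℂ)) *
        PowerSeries.coeff n (PowerSeries.mk β ^ d)‖ := norm_sum_le _ _
    _ ≤ ∑ d ∈ Finset.range (n + 1), (M * C) ^ d / (d.factorial : ℝ) *
        ((n : ℝ) + 1) ^ (-1 - γ) := by
        refine Finset.sum_le_sum fun d _ => ?_
        rw [norm_mul, norm_div, norm_one, Complex.norm_natCast]
        calc _ ≤ 1 / (d.factorial : ℝ) * ((M * C) ^ d * ((n : ℝ) + 1) ^ (-1 - γ)) :=
              mul_le_mul_of_nonneg_left (hpow d n) (by positivity)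
          _ = _ := by ring
    _ ≤ _ := by
        rw [← Finset.sum_mul]
        exact mul_le_mul_of_nonneg_right (Real.sum_le_exp_of_nonneg (by positivity) _)
          (by positivity)

theorem sum_range_inv_le {n : ℕ} (hn : 2 ≤ n) {m : ℕ} (hm : m ≤ n) :
    ∑ k ∈ Finset.range m, 1 / ((k : ℝ) + 1) ≤ 3 * Real.log n := by
  have h1 : ∑ k ∈ Finset.range m, 1 / ((k : ℝ) + 1) ≤ ∑ k ∈ Finset.range n, 1 / ((k : ℝ) + 1) :=
    Finset.sum_le_sum_of_subset_of_nonneg (Finset.range_subset_range.2 hm)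
      fun k _ _ => by positivity
  have h2 := harmonic_le_one_add_log n
  simp only [harmonic, Rat.cast_sum, Rat.cast_inv, Rat.cast_natCast] at h2
  push_cast at h2
  have h3 : Real.log 2 ≤ Real.log n := Real.log_le_log (by norm_num) (by exact_mod_cast hn)
  have h4 := Real.log_two_gt_d9
  simp only [one_div] at h1 ⊢
  linarith

/-- Split at `k ≈ n/2`. For small `k`, replace `c (n - k)` by `c n` at cost `k n^{θ-2}`. For large
`k`, `d k` is `O(n^{-1-γ})` while `∑ ‖c j‖ = O(n^θ log n)`. The missing tail of `S` is `O(n^{-γ})`.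
The three summands of the constant `Q` belong to these three pieces. -/
theorem exists_convolution_bound {γ θ : ℝ} (hγ : 0 < γ) (hγ1 : γ ≤ 1) (hθ : 0 ≤ θ) :
    ∃ Q : ℝ, 0 ≤ Q ∧ ∀ (c d : ℕ → ℂ) (A D : ℝ) (S : ℂ), 0 ≤ A → HasSum d S →
      ‖c 0‖ ≤ A → (∀ j : ℕ, 1 ≤ j → ‖c j‖ ≤ A * (j : ℝ) ^ (θ - 1)) →
      (∀ j : ℕ, 1 ≤ j → ‖c (j + 1) - c j‖ ≤ A * (j : ℝ) ^ (θ - 2)) →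
      (∀ k : ℕ, ‖d k‖ ≤ D * ((k : ℝ) + 1) ^ (-1 - γ)) →
      ∀ n : ℕ, 2 ≤ n → ‖∑ k ∈ Finset.range (n + 1), d k * c (n - k) - S * c n‖ ≤
        Q * A * D * ((n : ℝ) ^ (θ - 1 - γ) * Real.log n) := by
  refine ⟨2 ^ |θ - 2| * 3 + 2 ^ (1 + γ) * 5 + 2 ^ γ * γ⁻¹ * 2, by positivity, ?_⟩
  intro c d A D S hA hS hc0 hc hcd hd n hn
  have hD : 0 ≤ D := by
    have := (norm_nonneg _).trans (hd 0)
    simpa using this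
  have hn0 : (2 : ℝ) ≤ n := by exact_mod_cast hn
  have hnpos : (0 : ℝ) < n := by linarith
  have hlog : 1 ≤ 2 * Real.log n := by
    have h3 : Real.log 2 ≤ Real.log n := Real.log_le_log (by norm_num) hn0
    have h4 := Real.log_two_gt_d9
    linarith
  have hlog0 : 0 ≤ Real.log n := by linarith
  -- Then `m ≥ n/2`, while `k < m` forces `n - k ≥ n/2`.
  set m : ℕ := n / 2 + 1 with hm
  have hmn : m ≤ n := by lia
  have hm2 : (n : ℝ) / 2 ≤ m := by
    have : n ≤ 2 * m := by lia
    have : (n : ℝ) ≤ 2 * m := by exact_mod_cast this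
    linarith
  have hmpos : (0 : ℝ) < m := by linarith
  have hdiff : ∀ k : ℕ, k < m → ‖c (n - k) - c n‖ ≤
      k * (A * (2 ^ |θ - 2| * (n : ℝ) ^ (θ - 2))) := by
    intro k hk
    induction k with
    | zero => simp
    | succ k ih =>
      have ih := ih (by lia)
      set j := n - (k + 1) with hj
      have hj1 : n - k = j + 1 := by lia
      have hjpos : 1 ≤ j := by lia
      have h1 := hcd j hjpos
      have h2 : (j : ℝ) ^ (θ - 2) ≤ 2 ^ |θ - 2| * (n : ℝ) ^ (θ - 2) := by
        refine rpow_le_two_rpow_mul_rpow hnpos ?_ ?_ le_rfl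
        · have : n ≤ 2 * j := by lia
          have : (n : ℝ) ≤ 2 * j := by exact_mod_cast this
          linarith
        · have : j ≤ n := by lia
          have : (j : ℝ) ≤ n := by exact_mod_cast this
          linarith
      rw [hj1] at ih
      have h3 := norm_sub_le_norm_sub_add_norm_sub (c j) (c (j + 1)) (c n)
      rw [norm_sub_rev (c j) (c (j + 1))] at h3
      have h4 := mul_le_mul_of_nonneg_left h2 hA
      push_cast
      linarith
  have hT1 : ‖∑ k ∈ Finset.range m, d k * (c (n - k) - c n)‖ ≤
      2 ^ |θ - 2| * 3 * A * D * ((n : ℝ) ^ (θ - 1 - γ) * Real.log n) := by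
    calc _ ≤ ∑ k ∈ Finset.range m, ‖d k * (c (n - k) - c n)‖ := norm_sum_le _ _
      _ ≤ ∑ k ∈ Finset.range m, A * D * (2 ^ |θ - 2| * (n : ℝ) ^ (θ - 2)) *
          (n : ℝ) ^ (1 - γ) * (1 / ((k : ℝ) + 1)) := by
          refine Finset.sum_le_sum fun k hk => ?_
          have hk' := Finset.mem_range.1 hk
          have hk0 : (0 : ℝ) < (k : ℝ) + 1 := by positivity
          -- Extracting `n^{1-γ}`, which needs `γ ≤ 1`, leaves a harmonic sum and treats `γ = 1`
          -- together with `γ < 1`, at the price of a logarithm.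
          have h1 : (k : ℝ) * ((k : ℝ) + 1) ^ (-1 - γ) ≤
              (n : ℝ) ^ (1 - γ) * (1 / ((k : ℝ) + 1)) := by
            calc (k : ℝ) * ((k : ℝ) + 1) ^ (-1 - γ)
                ≤ ((k : ℝ) + 1) * ((k : ℝ) + 1) ^ (-1 - γ) := by
                  gcongr
                  exact le_add_of_nonneg_right zero_le_one
              _ = ((k : ℝ) + 1) ^ (1 - γ) * (1 / ((k : ℝ) + 1)) := by
                  rw [one_div, ← Real.rpow_neg_one ((k : ℝ) + 1), ← Real.rpow_add hk0]
                  nth_rewrite 1 [← Real.rpow_one ((k : ℝ) + 1)]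
                  rw [← Real.rpow_add hk0]
                  congr 1
                  ring
              _ ≤ _ := by
                  have : (k : ℝ) + 1 ≤ n := by
                    have : k + 1 ≤ n := by lia
                    exact_mod_cast this
                  gcongr
          rw [norm_mul]
          calc _ ≤ _ := mul_le_mul (hd k) (hdiff k hk') (norm_nonneg _) (by positivity)
            _ = A * D * (2 ^ |θ - 2| * (n : ℝ) ^ (θ - 2)) *
                ((k : ℝ) * ((k : ℝ) + 1) ^ (-1 - γ)) := by ring
            _ ≤ A * D * (2 ^ |θ - 2| * (n : ℝ) ^ (θ - 2)) *
                ((n : ℝ) ^ (1 - γ) * (1 / ((k : ℝ) + 1))) :=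
                mul_le_mul_of_nonneg_left h1 (by positivity)
            _ = _ := by ring
      _ ≤ A * D * (2 ^ |θ - 2| * (n : ℝ) ^ (θ - 2)) * (n : ℝ) ^ (1 - γ) *
          (3 * Real.log n) := by
          rw [← Finset.mul_sum]
          exact mul_le_mul_of_nonneg_left (sum_range_inv_le hn hmn) (by positivity)
      _ = _ := by
          have : (n : ℝ) ^ (θ - 1 - γ) = (n : ℝ) ^ (θ - 2) * (n : ℝ) ^ (1 - γ) := by
            rw [← Real.rpow_add hnpos]
            congr 1
            ring
          rw [this]
          ring
  have hT2 : ‖∑ k ∈ Finset.Ico m (n + 1), d k * c (n - k)‖ ≤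
      2 ^ (1 + γ) * 5 * A * D * ((n : ℝ) ^ (θ - 1 - γ) * Real.log n) := by
    have hdk : ∀ k ∈ Finset.Ico m (n + 1), ‖d k‖ ≤ D * (2 ^ (1 + γ) * (n : ℝ) ^ (-1 - γ)) := by
      intro k hk
      refine (hd k).trans (mul_le_mul_of_nonneg_left ?_ hD)
      have h1 : (n : ℝ) / 2 ≤ (k : ℝ) + 1 := by
        have : (m : ℝ) ≤ k := by exact_mod_cast (Finset.mem_Ico.1 hk).1
        linarith
      calc ((k : ℝ) + 1) ^ (-1 - γ) ≤ ((n : ℝ) / 2) ^ (-1 - γ) :=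
            Real.rpow_le_rpow_of_nonpos (by positivity) h1 (by linarith)
        _ = _ := by
            rw [Real.div_rpow hnpos.le (by norm_num), show -1 - γ = -(1 + γ) by ring,
              Real.rpow_neg (by norm_num : (0 : ℝ) ≤ 2)]
            field_simp
    have hsum : ∑ k ∈ Finset.Ico m (n + 1), ‖c (n - k)‖ ≤
        A * ((n : ℝ) ^ θ * (5 * Real.log n)) := by
      have h1 : ∑ k ∈ Finset.Ico m (n + 1), ‖c (n - k)‖ ≤
          ∑ k ∈ Finset.range (n + 1), ‖c (n - k)‖ := by
        refine Finset.sum_le_sum_of_subset_of_nonneg (fun k hk => ?_) fun k _ _ => norm_nonneg _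
        exact Finset.mem_range.2 (Finset.mem_Ico.1 hk).2
      have h2 : ∑ k ∈ Finset.range (n + 1), ‖c (n - k)‖ =
          ∑ k ∈ Finset.range (n + 1), ‖c k‖ := by
        simpa using Finset.sum_range_reflect (fun k => ‖c k‖) (n + 1)
      have hnθ : (1 : ℝ) ≤ (n : ℝ) ^ θ := Real.one_le_rpow (by linarith) hθ
      -- The same device: `j^{θ-1} ≤ n^θ / j` for `j ≤ n`.
      have h3 : ∀ k ∈ Finset.range n, ‖c (k + 1)‖ ≤
          A * (n : ℝ) ^ θ * (1 / ((k : ℝ) + 1)) := by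
        intro k hk
        refine (hc (k + 1) (by lia)).trans ?_
        rw [mul_assoc]
        refine mul_le_mul_of_nonneg_left ?_ hA
        have hk0 : (0 : ℝ) < ((k + 1 : ℕ) : ℝ) := by positivity
        rw [Real.rpow_sub hk0, Real.rpow_one, div_eq_mul_one_div]
        push_cast
        have : (k : ℝ) + 1 ≤ n := by exact_mod_cast Finset.mem_range.1 hk
        gcongr
      rw [h2, Finset.sum_range_succ'] at h1
      have h4 := Finset.sum_le_sum h3
      rw [← Finset.mul_sum] at h4
      have h5 := mul_le_mul_of_nonneg_left (sum_range_inv_le hn le_rfl)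
        (show 0 ≤ A * (n : ℝ) ^ θ by positivity)
      have h6 : A * 1 ≤ A * ((n : ℝ) ^ θ * (2 * Real.log n)) :=
        mul_le_mul_of_nonneg_left (by nlinarith) hA
      linarith
    calc _ ≤ ∑ k ∈ Finset.Ico m (n + 1), ‖d k * c (n - k)‖ := norm_sum_le _ _
      _ ≤ ∑ k ∈ Finset.Ico m (n + 1), D * (2 ^ (1 + γ) * (n : ℝ) ^ (-1 - γ)) * ‖c (n - k)‖ :=
          Finset.sum_le_sum fun k hk => by
            rw [norm_mul]
            exact mul_le_mul_of_nonneg_right (hdk k hk) (norm_nonneg _)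
      _ ≤ D * (2 ^ (1 + γ) * (n : ℝ) ^ (-1 - γ)) * (A * ((n : ℝ) ^ θ * (5 * Real.log n))) := by
          rw [← Finset.mul_sum]
          exact mul_le_mul_of_nonneg_left hsum (by positivity)
      _ = _ := by
          have : (n : ℝ) ^ (θ - 1 - γ) = (n : ℝ) ^ (-1 - γ) * (n : ℝ) ^ θ := by
            rw [← Real.rpow_add hnpos]
            congr 1
            ring
          rw [this]
          ring
  have hT3 : ‖(S - ∑ k ∈ Finset.range m, d k) * c n‖ ≤
      2 ^ γ * γ⁻¹ * 2 * A * D * ((n : ℝ) ^ (θ - 1 - γ) * Real.log n) := by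
    have h1 := norm_sub_sum_le hγ hS hd (show 1 ≤ m by lia)
    have h2 : (m : ℝ) ^ (-γ) ≤ 2 ^ γ * (n : ℝ) ^ (-γ) := by
      calc (m : ℝ) ^ (-γ) ≤ ((n : ℝ) / 2) ^ (-γ) :=
            Real.rpow_le_rpow_of_nonpos (by positivity) hm2 (by linarith)
        _ = _ := by
            rw [Real.div_rpow hnpos.le (by norm_num), Real.rpow_neg (by norm_num : (0 : ℝ) ≤ 2)]
            field_simp
    have h3 : (n : ℝ) ^ (θ - 1 - γ) = (n : ℝ) ^ (-γ) * (n : ℝ) ^ (θ - 1) := by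
      rw [← Real.rpow_add hnpos]
      congr 1
      ring
    rw [norm_mul]
    calc _ ≤ D * (γ⁻¹ * (2 ^ γ * (n : ℝ) ^ (-γ))) * (A * (n : ℝ) ^ (θ - 1)) := by
          refine mul_le_mul (h1.trans ?_) (hc n (by lia)) (norm_nonneg _) (by positivity)
          gcongr
      _ = D * (γ⁻¹ * (2 ^ γ * (n : ℝ) ^ (-γ))) * (A * (n : ℝ) ^ (θ - 1)) * 1 := by ring
      _ ≤ D * (γ⁻¹ * (2 ^ γ * (n : ℝ) ^ (-γ))) * (A * (n : ℝ) ^ (θ - 1)) *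
          (2 * Real.log n) := mul_le_mul_of_nonneg_left hlog (by positivity)
      _ = _ := by
          rw [h3]
          ring
  have hsplit : ∑ k ∈ Finset.range (n + 1), d k * c (n - k) - S * c n =
      ∑ k ∈ Finset.range m, d k * (c (n - k) - c n) +
        ∑ k ∈ Finset.Ico m (n + 1), d k * c (n - k) -
          (S - ∑ k ∈ Finset.range m, d k) * c n := by
    rw [← Finset.sum_range_add_sum_Ico _ (show m ≤ n + 1 by lia)]
    simp only [mul_sub, Finset.sum_sub_distrib, sub_mul, Finset.sum_mul]
    ring
  rw [hsplit]
  refine (norm_sub_le _ _).trans ((add_le_add ((norm_add_le _ _).trans (add_le_add hT1 hT2))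
    hT3).trans (le_of_eq ?_))
  ring

end Convolution

end WeightedPerm

/-! ### Coefficient asymptotics in class `e𝓕` -/

namespace WeightedPerm

section ClassEF

/-- By the product rule, the product solves the equation that characterises `exp (F + G)`. -/
theorem exp_subst_add {F G : PowerSeries ℂ} (hF : PowerSeries.constantCoeff F = 0)
    (hG : PowerSeries.constantCoeff G = 0) :
    (PowerSeries.exp ℂ).subst F * (PowerSeries.exp ℂ).subst G =
      ((PowerSeries.exp ℂ).subst (F + G) : PowerSeries ℂ) := by
  have hd : ∀ {H : PowerSeries ℂ}, PowerSeries.constantCoeff H = 0 →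
      PowerSeries.derivative ℂ ((PowerSeries.exp ℂ).subst H : PowerSeries ℂ) =
        ((PowerSeries.exp ℂ).subst H : PowerSeries ℂ) * PowerSeries.derivative ℂ H := by
    intro H hH
    rw [PowerSeries.derivative_subst (PowerSeries.HasSubst.of_constantCoeff_zero' hH),
      PowerSeries.derivative_exp]
  have h0 : ∀ {H : PowerSeries ℂ}, PowerSeries.constantCoeff H = 0 →
      PowerSeries.coeff 0 ((PowerSeries.exp ℂ).subst H : PowerSeries ℂ) = 1 := by
    intro H hH
    rw [coeff_exp_subst hH]
    simp
  set A : PowerSeries ℂ := (PowerSeries.exp ℂ).subst F with hA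
  set B : PowerSeries ℂ := (PowerSeries.exp ℂ).subst G with hB
  apply eq_exp_subst
  · rw [map_add, hF, hG, add_zero]
  · rw [PowerSeries.coeff_mul]
    simp [h0 hF, h0 hG, hA, hB]
  · intro n
    have h1 : PowerSeries.derivative ℂ (A * B) = PowerSeries.derivative ℂ (F + G) * (A * B) := by
      rw [Derivation.leibniz, smul_eq_mul, smul_eq_mul, map_add, hA, hB, hd hF, hd hG]
      ring
    have h2 := congrArg (PowerSeries.coeff n) h1
    rw [PowerSeries.coeff_derivative] at h2
    rw [mul_comm, h2, PowerSeries.coeff_mul]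
    refine Finset.sum_congr rfl fun p _ => ?_
    rw [PowerSeries.coeff_derivative, mul_comm (PowerSeries.coeff _ (F + G))]

/-- The identity holds inside the disc; Abel's theorem on both sides carries it to `t = 1`. -/
theorem hasSum_coeff_exp_subst {β : ℕ → ℂ} {K : ℂ} (hβ0 : β 0 = 0)
    (hβ : Summable fun n => ‖β n‖) (hK : HasSum β K)
    (hd : Summable fun n =>
      ‖PowerSeries.coeff n ((PowerSeries.exp ℂ).subst (PowerSeries.mk β))‖) :
    HasSum (fun n => PowerSeries.coeff n ((PowerSeries.exp ℂ).subst (PowerSeries.mk β)))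
      (Complex.exp K) := by
  set d : ℕ → ℂ := fun n =>
    PowerSeries.coeff n ((PowerSeries.exp ℂ).subst (PowerSeries.mk β)) with hddef
  have hβt : ∀ t : ℂ, ‖t‖ < 1 → HasSum (fun n => β n * t ^ n) (∑' n, β n * t ^ n) := by
    intro t ht
    refine (Summable.of_norm_bounded hβ fun n => ?_).hasSum
    rw [norm_mul, norm_pow]
    exact mul_le_of_le_one_right (norm_nonneg _) (pow_le_one₀ (norm_nonneg _) ht.le)
  have hdt : ∀ t : ℂ, ‖t‖ < 1 → ∑' n, d n * t ^ n = Complex.exp (∑' n, β n * t ^ n) := by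
    intro t ht
    have h1 := Complex.hasSum_taylorSeries_on_ball (r := 1)
      (by simpa using (differentiableOn_of_hasSum hβt).cexp) (z := t) (by simpa using ht)
    refine HasSum.tsum_eq ?_
    refine h1.congr_fun fun n => ?_
    rw [hddef]
    simp only [coeff_exp_subst_eq_iteratedDeriv hβ0 hβt, sub_zero, smul_eq_mul]
    ring
  have hlim1 := Complex.tendsto_tsum_powerSeries_nhdsWithin_lt hK.tendsto_sum_nat
  have hlim2 := Complex.tendsto_tsum_powerSeries_nhdsWithin_lt hd.of_norm.hasSum.tendsto_sum_nat
  rw [tendsto_map'_iff] at hlim1 hlim2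
  have h3 := (Complex.continuous_exp.tendsto K).comp hlim1
  have h4 : ∑' n, d n = Complex.exp K := by
    refine tendsto_nhds_unique hlim2 (h3.congr' ?_)
    have hmem : Set.Ioo (0 : ℝ) 1 ∈ 𝓝[<] (1 : ℝ) := Ioo_mem_nhdsLT one_pos
    filter_upwards [hmem] with x hx
    have hx1 : ‖(x : ℂ)‖ < 1 := by
      rw [Complex.norm_real, Real.norm_of_nonneg hx.1.le]
      exact hx.2
    exact (hdt x hx1).symm
  rw [← h4]
  exact hd.of_norm.hasSum

theorem IsClassEF.exists_coeffs {G : PowerSeries ℂ} {r θ γ : ℝ} {K : ℂ}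
    (hG : IsClassEF G r θ γ K) (hG0 : PowerSeries.constantCoeff G = 0) :
    ∃ (β : ℕ → ℂ) (M : ℝ), β 0 = 0 ∧
      (∀ n : ℕ, PowerSeries.coeff n G * (r : ℂ) ^ n = θ / (n : ℂ) + β n) ∧
      (∀ n : ℕ, ‖β n‖ ≤ M * ((n : ℝ) + 1) ^ (-1 - γ)) ∧ HasSum β K := by
  obtain ⟨hr, -, hγ, -, g₀, b, hb, hGb, hbO, hK⟩ := hG
  have hr0 : (r : ℂ) ≠ 0 := by exact_mod_cast hr.ne'
  have hscale : ∀ t : ℂ, ‖t‖ < 1 → ‖(r : ℂ) * t‖ < r := by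
    intro t ht
    rw [norm_mul, Complex.norm_real, Real.norm_of_nonneg hr.le]
    nlinarith
  have hcoeff : ∀ n : ℕ, PowerSeries.coeff n G * (r : ℂ) ^ n = θ / (n : ℂ) + b n * (r : ℂ) ^ n := by
    have h1 : ∀ t : ℂ, ‖t‖ < 1 → HasSum (fun n : ℕ => PowerSeries.coeff n G * (r : ℂ) ^ n * t ^ n)
        ((θ : ℂ) * -Complex.log (1 - t) + g₀ (r * t)) := by
      intro t ht
      have h2 := hGb _ (hscale t ht)
      have hsl : 1 - t ∈ Complex.slitPlane := by
        refine Complex.mem_slitPlane_iff.2 (Or.inl ?_)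
        have := (Complex.re_le_norm t).trans_lt ht
        simpa using this
      rw [mul_div_cancel_left₀ _ hr0, one_div, Complex.log_inv _
        (Complex.slitPlane_arg_ne_pi hsl)] at h2
      simpa only [mul_pow, mul_assoc] using h2
    have h2 : ∀ t : ℂ, ‖t‖ < 1 → HasSum (fun n : ℕ => (θ / (n : ℂ) + b n * (r : ℂ) ^ n) * t ^ n)
        ((θ : ℂ) * -Complex.log (1 - t) + g₀ (r * t)) := by
      intro t ht
      refine (((Complex.hasSum_taylorSeries_neg_log ht).mul_left (θ : ℂ)).add
        (hb _ (hscale t ht))).congr_fun fun n => ?_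
      rw [mul_pow]
      ring
    intro n
    have h3 := (iteratedDeriv_of_hasSum h1 n).symm.trans (iteratedDeriv_of_hasSum h2 n)
    exact mul_left_cancel₀ (Nat.cast_ne_zero.2 (Nat.factorial_ne_zero n)) h3
  -- With `n + 1` the weight is nonzero at `n = 0` as well, so the asymptotic bound becomes one
  -- valid for every `n`.
  have hbO' : (fun n : ℕ => b n * (r : ℂ) ^ n) =O[atTop]
      fun n : ℕ => ((n : ℝ) + 1) ^ (-1 - γ) := by
    have h1 : (fun n : ℕ => b n * (r : ℂ) ^ n) =O[atTop]
        fun n : ℕ => r ^ (-(n : ℝ)) * (n : ℝ) ^ (-1 - γ) * ‖(r : ℂ) ^ n‖ :=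
      hbO.mul (isBigO_refl _ _).norm_right
    refine h1.trans (IsBigO.of_bound (2 ^ |(-1 - γ)|) ?_)
    filter_upwards [eventually_ge_atTop 1] with n hn
    have hn0 : (1 : ℝ) ≤ n := by exact_mod_cast hn
    have h2 : r ^ (-(n : ℝ)) * (n : ℝ) ^ (-1 - γ) * ‖(r : ℂ) ^ n‖ = (n : ℝ) ^ (-1 - γ) := by
      rw [norm_pow, Complex.norm_real, Real.norm_of_nonneg hr.le, Real.rpow_neg hr.le,
        Real.rpow_natCast]
      field_simp
    rw [h2, Real.norm_of_nonneg (by positivity), Real.norm_of_nonneg (by positivity)]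
    exact rpow_le_two_rpow_mul_rpow (by positivity) (by linarith) (by linarith) le_rfl
  obtain ⟨M, -, hM⟩ := bound_of_isBigO_nat_atTop hbO'
  refine ⟨fun n => b n * (r : ℂ) ^ n, M, ?_, hcoeff, fun n => ?_, hK⟩
  -- `G` has no constant term, and `θ / 0 = 0`.
  · have := hcoeff 0
    rw [PowerSeries.coeff_zero_eq_constantCoeff_apply, hG0] at this
    simpa using this.symm
  · have h1 : ((n : ℝ) + 1) ^ (-1 - γ) ≠ 0 := by positivity
    have := hM h1
    rwa [Real.norm_of_nonneg (by positivity)] at this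

theorem norm_risingCoeff_le {C : ℝ} {α : ℂ} {θ : ℝ} (hα : α.re ≤ θ) {n : ℕ} (hn : 1 ≤ n)
    (h : ‖risingCoeffNormalized α n‖ ≤ C) : ‖risingCoeff α n‖ ≤ C * (n : ℝ) ^ (θ - 1) := by
  have hn0 : (1 : ℝ) ≤ n := by exact_mod_cast hn
  rw [risingCoeff_eq α hn, norm_mul, Complex.norm_natCast_cpow_of_pos hn]
  refine mul_le_mul h (Real.rpow_le_rpow_of_exponent_le hn0 ?_) (by positivity)
    ((norm_nonneg _).trans h)
  simpa using hα

/-- The rescaled coefficients are the convolution of those of `exp (w ∑ β_k t^k)`, which sum to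
`e^{wK}`, with those of `(1 - t)^{-wθ}`. -/
theorem IsClassEF.exists_coeff_bound {G : PowerSeries ℂ} {r θ γ : ℝ} {K : ℂ}
    (hG : IsClassEF G r θ γ K) (hG0 : PowerSeries.constantCoeff G = 0) :
    ∃ C : ℝ, 0 ≤ C ∧ ∀ n : ℕ, 2 ≤ n → ∀ w : ℂ, ‖w‖ = 1 →
      ‖(r : ℂ) ^ n * PowerSeries.coeff n ((PowerSeries.exp ℂ).subst (w • G)) -
        Complex.exp (w * K) * risingCoeff (w * θ) n‖ ≤
          C * ((n : ℝ) ^ (θ - 1 - γ) * Real.log n) := by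
  obtain ⟨β, M, hβ0, hβ, hβM, hβK⟩ := hG.exists_coeffs hG0
  obtain ⟨-, hθ, hγ, hγ1, -⟩ := hG
  obtain ⟨D, hD, hexp⟩ := exists_exp_subst_coeff_le hγ M
  obtain ⟨U, hU, hrise⟩ := exists_bound_risingCoeffNormalized θ
  obtain ⟨Q, hQ, hconv⟩ := exists_convolution_bound hγ hγ1 hθ
  -- Covers at once the size `U` of the coefficients, the factor `θ + 1` in their differences, and
  -- the zeroth coefficient `1`.
  set A : ℝ := U * (θ + 1) + 1 with hA
  have hA0 : 0 ≤ A := by positivity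
  refine ⟨Q * A * D, by positivity, fun n hn w hw => ?_⟩
  have hwβ0 : w * β 0 = 0 := by rw [hβ0, mul_zero]
  have hwβ : ∀ k, ‖w * β k‖ ≤ M * ((k : ℝ) + 1) ^ (-1 - γ) := fun k => by
    rw [norm_mul, hw, one_mul]
    exact hβM k
  have hd := hexp (fun k => w * β k) hwβ0 hwβ
  have hS := hasSum_coeff_exp_subst hwβ0
    (((summable_weight hγ).mul_left M).of_nonneg_of_le (fun _ => norm_nonneg _) hwβ)
    (hβK.mul_left w)
    (((summable_weight hγ).mul_left D).of_nonneg_of_le (fun _ => norm_nonneg _) hd)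
  have hαnorm : ‖w * (θ : ℂ)‖ ≤ θ := by
    rw [norm_mul, hw, one_mul, Complex.norm_real, Real.norm_of_nonneg hθ]
  have hαre : (w * (θ : ℂ)).re ≤ θ := (Complex.re_le_norm _).trans hαnorm
  obtain ⟨-, hr2⟩ := hrise _ hαnorm
  have hc : ∀ j : ℕ, 1 ≤ j → ‖risingCoeff (w * θ) j‖ ≤ U * (j : ℝ) ^ (θ - 1) := fun j hj =>
    norm_risingCoeff_le hαre hj (hr2 j hj).1
  have hUA : U ≤ A := by nlinarith
  have hcd : ∀ j : ℕ, 1 ≤ j → ‖risingCoeff (w * θ) (j + 1) - risingCoeff (w * θ) j‖ ≤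
      A * (j : ℝ) ^ (θ - 2) := by
    intro j hj
    have hj0 : (1 : ℝ) ≤ j := by exact_mod_cast hj
    have hjc : ((j : ℂ) + 1) ≠ 0 := Nat.cast_add_one_ne_zero j
    have h1 : risingCoeff (w * θ) (j + 1) - risingCoeff (w * θ) j =
        risingCoeff (w * θ) j * ((w * θ - 1) / ((j : ℂ) + 1)) := by
      have := risingCoeff_succ (w * θ) j
      field_simp
      linear_combination this
    have h2 : ‖(w * (θ : ℂ) - 1) / ((j : ℂ) + 1)‖ ≤ (θ + 1) / j := by
      have h3 : ‖(j : ℂ) + 1‖ = (j : ℝ) + 1 := by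
        have := Complex.norm_natCast (j + 1)
        push_cast at this
        exact this
      have h4 := norm_sub_le (w * (θ : ℂ)) 1
      rw [norm_one] at h4
      rw [norm_div, h3]
      exact div_le_div₀ (by linarith) (by linarith) (by linarith) (by linarith)
    have h5 : (j : ℝ) ^ (θ - 1) / j = (j : ℝ) ^ (θ - 2) := by
      rw [← Real.rpow_sub_one (by positivity)]
      congr 1
      ring
    rw [h1, norm_mul]
    calc _ ≤ U * (j : ℝ) ^ (θ - 1) * ((θ + 1) / j) :=
          mul_le_mul (hc j hj) h2 (norm_nonneg _) (by positivity)
      _ = U * (θ + 1) * ((j : ℝ) ^ (θ - 1) / j) := by ring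
      _ ≤ _ := by
          rw [h5]
          exact mul_le_mul_of_nonneg_right (by linarith) (by positivity)
  have hmain := hconv (risingCoeff (w * θ)) _ A D _ hA0 hS (by
    simp only [risingCoeff, Finset.range_zero, Finset.prod_empty, Nat.factorial_zero,
      Nat.cast_one, div_one, norm_one]
    nlinarith) (fun j hj => (hc j hj).trans (mul_le_mul_of_nonneg_right hUA (by positivity))) hcd hd
    n hn
  have hprod : (r : ℂ) ^ n * PowerSeries.coeff n ((PowerSeries.exp ℂ).subst (w • G)) =
      ∑ k ∈ Finset.range (n + 1), PowerSeries.coeff k ((PowerSeries.exp ℂ).subst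
        (PowerSeries.mk fun k => w * β k)) * risingCoeff (w * θ) (n - k) := by
    have h1 : (PowerSeries.mk fun k => w * (PowerSeries.coeff k G * (r : ℂ) ^ k)) =
        (PowerSeries.mk fun k => w * β k) + PowerSeries.mk fun k : ℕ => w * θ / (k : ℂ) := by
      ext k
      rw [map_add, PowerSeries.coeff_mk, PowerSeries.coeff_mk, PowerSeries.coeff_mk, hβ]
      ring
    rw [← coeff_exp_subst_rescale hG0, h1, ← exp_subst_add (by simpa using hwβ0) (by simp),
      ← mk_risingCoeff, PowerSeries.coeff_mul,
      Finset.Nat.sum_antidiagonal_eq_sum_range_succ_mk]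
    simp only [PowerSeries.coeff_mk]
  rw [hprod]
  exact hmain

end ClassEF

end WeightedPerm

/-! ### Quotients of coefficients and the characteristic function -/

namespace WeightedPerm

section Expectation

/-- A perturbation of at most `|x|/2` keeps the denominator above `|x|/2`. The bound depends on `y`
only through `B`, hence is uniform in `s`. -/
theorem norm_div_sub_div_le {x y dx dy : ℂ} {η B : ℝ} (hx : x ≠ 0) (hdx : ‖dx‖ ≤ η)
    (hdy : ‖dy‖ ≤ η) (hy : ‖y‖ ≤ B) (hη : η ≤ ‖x‖ / 2) :
    x + dx ≠ 0 ∧ ‖(y + dy) / (x + dx) - y / x‖ ≤ 2 * (‖x‖ + B) / ‖x‖ ^ 2 * η := by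
  have hxpos : 0 < ‖x‖ := norm_pos_iff.2 hx
  have hη0 : 0 ≤ η := (norm_nonneg _).trans hdx
  have hlow : ‖x‖ / 2 ≤ ‖x + dx‖ := by
    have := norm_sub_norm_le x (-dx)
    rw [sub_neg_eq_add, norm_neg] at this
    linarith
  have hne : x + dx ≠ 0 := norm_pos_iff.1 (by linarith)
  refine ⟨hne, ?_⟩
  have h1 : (y + dy) / (x + dx) - y / x = (x * dy - y * dx) / (x * (x + dx)) := by
    field_simp
    ring
  have h2 : ‖x * dy - y * dx‖ ≤ (‖x‖ + B) * η := by
    refine (norm_sub_le _ _).trans ?_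
    rw [norm_mul, norm_mul, add_mul]
    exact add_le_add (mul_le_mul_of_nonneg_left hdy hxpos.le)
      (mul_le_mul hy hdx (norm_nonneg _) ((norm_nonneg _).trans hy))
  rw [h1, norm_div, norm_mul, div_le_iff₀ (by positivity)]
  refine h2.trans ?_
  have h3 : (‖x‖ + B) * η = 2 * (‖x‖ + B) / ‖x‖ ^ 2 * η * (‖x‖ * (‖x‖ / 2)) := by
    field_simp
  rw [h3]
  have hB : 0 ≤ B := (norm_nonneg _).trans hy
  gcongr

theorem norm_exp_I_mul (s : ℝ) : ‖Complex.exp (Complex.I * (s : ℂ))‖ = 1 := by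
  rw [mul_comm, Complex.norm_exp_ofReal_mul_I]

theorem norm_exp_mul_le {w : ℂ} (hw : ‖w‖ = 1) (K : ℂ) :
    ‖Complex.exp (w * K)‖ ≤ Real.exp ‖K‖ := by
  refine (Complex.norm_exp_le_exp_norm _).trans (le_of_eq ?_)
  rw [norm_mul, hw, one_mul]

theorem constantCoeff_gSeries (Θ : ℕ → ℝ) : PowerSeries.constantCoeff (gSeries Θ) = 0 := by
  simp [gSeries]

theorem h_mul_expect_eq_coeff {Θ : ℕ → ℝ} (hΘ : ∀ m : ℕ, 1 ≤ m → 0 ≤ Θ m) (w : ℂ) (n : ℕ) :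
    (h Θ n : ℂ) * expect Θ (fun σ : Equiv.Perm (Fin n) =>
      Complex.exp (w * (totalCycles σ : ℂ))) =
    PowerSeries.coeff n ((PowerSeries.exp ℂ).subst (Complex.exp w • gSeries Θ)) := by
  rw [← mk_h_mul_expect hΘ, PowerSeries.coeff_mk]

theorem h_eq_coeff {Θ : ℕ → ℝ} (hΘ : ∀ m : ℕ, 1 ≤ m → 0 ≤ Θ m) (n : ℕ) :
    (h Θ n : ℂ) =
      PowerSeries.coeff n ((PowerSeries.exp ℂ).subst ((1 : ℂ) • gSeries Θ)) := by
  have h1 := h_mul_expect_eq_coeff hΘ 0 n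
  rw [Complex.exp_zero] at h1
  rw [← h1]
  by_cases h0 : h Θ n = 0
  · rw [h0]
    simp
  · have h2 := sum_prob Θ n h0
    have h3 : expect Θ (fun σ : Equiv.Perm (Fin n) =>
        Complex.exp (0 * (totalCycles σ : ℂ))) = 1 := by
      unfold expect
      simp only [zero_mul, Complex.exp_zero, mul_one]
      exact_mod_cast h2
    rw [h3, mul_one]

theorem expect_eq_div {Θ : ℕ → ℝ} (hΘ : ∀ m : ℕ, 1 ≤ m → 0 ≤ Θ m) {n : ℕ} {c : ℂ}
    (hc : c * PowerSeries.coeff n ((PowerSeries.exp ℂ).subst ((1 : ℂ) • gSeries Θ)) ≠ 0)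
    (w : ℂ) :
    h Θ n ≠ 0 ∧ expect Θ (fun σ : Equiv.Perm (Fin n) =>
      Complex.exp (w * (totalCycles σ : ℂ))) =
      (c * PowerSeries.coeff n ((PowerSeries.exp ℂ).subst (Complex.exp w • gSeries Θ))) /
        (c * PowerSeries.coeff n ((PowerSeries.exp ℂ).subst ((1 : ℂ) • gSeries Θ))) := by
  have hc0 := left_ne_zero_of_mul hc
  have hc1 := right_ne_zero_of_mul hc
  rw [← h_eq_coeff hΘ] at hc1 ⊢
  refine ⟨by exact_mod_cast hc1, ?_⟩
  rw [← h_mul_expect_eq_coeff hΘ]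
  field_simp

/-- Dividing by `n^{wθ-1} e^{wK}` leaves `1/Γ(wθ) + O(1/n)`, since the coefficient error carries the
same power `n^{θ Re w}`. The ratio of the normalisers at `w` and at `1` is the stated prefactor. -/
theorem expect_asymptotic_of_isClassF {Θ : ℕ → ℝ} (hΘ : ∀ m : ℕ, 1 ≤ m → 0 ≤ Θ m)
    {r θ : ℝ} {K : ℂ} (hθ : 0 < θ) (hG : IsClassF (gSeries Θ) r θ K) :
    ∃ (ε : ℕ → ℝ → ℂ) (C : ℝ), ∀ᶠ n : ℕ in atTop, ∀ s : ℝ,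
      h Θ n ≠ 0 ∧
      expect Θ (fun σ : Equiv.Perm (Fin n) =>
          Complex.exp (Complex.I * (s : ℂ) * (totalCycles σ : ℂ))) =
        (n : ℂ) ^ ((θ : ℂ) * (Complex.exp (Complex.I * (s : ℂ)) - 1)) *
          Complex.exp (K * (Complex.exp (Complex.I * (s : ℂ)) - 1)) *
          (Complex.Gamma (θ : ℂ) /
            Complex.Gamma ((θ : ℂ) * Complex.exp (Complex.I * (s : ℂ))) + ε n s) ∧
      ‖ε n s‖ ≤ C * (1 / (n : ℝ)) := by
  obtain ⟨C, hC, n₀, hcoeff⟩ := hG.exists_coeff_bound (constantCoeff_gSeries Θ)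
  obtain ⟨U, hU, hrise⟩ := exists_bound_risingCoeffNormalized θ
  set q : ℕ → ℂ → ℂ := fun n w =>
    (r : ℂ) ^ n * PowerSeries.coeff n ((PowerSeries.exp ℂ).subst (w • gSeries Θ)) with hq
  set p : ℕ → ℂ → ℂ := fun n w => (n : ℂ) ^ (w * θ - 1) * Complex.exp (w * K) with hp
  have hp0 : ∀ n : ℕ, 1 ≤ n → ∀ w : ℂ, p n w ≠ 0 := fun n hn w =>
    mul_ne_zero (by simp [Complex.cpow_eq_zero_iff, Nat.one_le_iff_ne_zero.1 hn])
      (Complex.exp_ne_zero _)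
  set C₁ : ℝ := C * Real.exp ‖K‖ + U with hC₁
  set δ : ℕ → ℂ → ℂ := fun n w => q n w / p n w - (Complex.Gamma (w * θ))⁻¹ with hδ
  have hδle : ∀ n : ℕ, max n₀ 1 ≤ n → ∀ w : ℂ, ‖w‖ = 1 → ‖δ n w‖ ≤ C₁ * (1 / n) := by
    intro n hn w hw
    have hn1 : 1 ≤ n := (le_max_right _ _).trans hn
    have hnpos : (0 : ℝ) < n := by exact_mod_cast hn1
    have hαnorm : ‖w * (θ : ℂ)‖ ≤ θ := by
      rw [norm_mul, hw, one_mul, Complex.norm_real, Real.norm_of_nonneg hθ.le]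
    have h1 : δ n w = (q n w - Complex.exp (w * K) * risingCoeff (w * θ) n) / p n w +
        (risingCoeffNormalized (w * θ) n - (Complex.Gamma (w * θ))⁻¹) := by
      have h2 : Complex.exp (w * K) * risingCoeff (w * θ) n =
          risingCoeffNormalized (w * θ) n * p n w := by
        rw [risingCoeff_eq _ hn1, hp]
        ring
      rw [hδ, h2]
      have := hp0 n hn1 w
      field_simp
      ring
    have h3 : ‖p n w‖⁻¹ ≤ (n : ℝ) ^ (1 - θ * w.re) * Real.exp ‖K‖ := by
      have h4 : (w * (θ : ℂ) - 1).re = θ * w.re - 1 := by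
        simp [mul_comm]
      rw [hp]
      simp only
      rw [norm_mul, mul_inv, Complex.norm_natCast_cpow_of_pos hn1, h4, ← Real.rpow_neg hnpos.le,
        neg_sub, ← norm_inv, ← Complex.exp_neg]
      refine mul_le_mul_of_nonneg_left ?_ (by positivity)
      have := norm_exp_mul_le hw (-K)
      rwa [mul_neg, norm_neg] at this
    have h5 := hcoeff n ((le_max_left _ _).trans hn) w hw
    have h6 := ((hrise _ hαnorm).2 n hn1).2
    have h7 : (n : ℝ) ^ (θ * w.re - 2) * (n : ℝ) ^ (1 - θ * w.re) = 1 / n := by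
      rw [← Real.rpow_add hnpos, one_div, ← Real.rpow_neg_one]
      congr 1
      ring
    rw [h1]
    refine (norm_add_le _ _).trans ?_
    rw [norm_div, div_eq_mul_inv]
    calc _ ≤ C * (n : ℝ) ^ (θ * w.re - 2) * ((n : ℝ) ^ (1 - θ * w.re) * Real.exp ‖K‖) +
          U * (1 / n) :=
          add_le_add (mul_le_mul h5 h3 (by positivity) (by positivity)) h6
      _ = _ := by
          rw [hC₁]
          linear_combination C * Real.exp ‖K‖ * h7
  set x : ℂ := (Complex.Gamma θ)⁻¹ with hx
  have hx0 : x ≠ 0 := inv_ne_zero (Complex.Gamma_ne_zero_of_re_pos (by simpa using hθ))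
  -- This threshold on `n` is independent of `s`; past it the denominator, hence `h_n`, is nonzero.
  have hsmall : ∀ᶠ n : ℕ in atTop, C₁ * (1 / (n : ℝ)) ≤ ‖x‖ / 2 := by
    have h1 : Tendsto (fun n : ℕ => C₁ * (1 / (n : ℝ))) atTop (𝓝 (C₁ * 0)) :=
      tendsto_one_div_atTop_nhds_zero_nat.const_mul C₁
    rw [mul_zero] at h1
    exact (h1.eventually_lt_const (half_pos (norm_pos_iff.2 hx0))).mono fun n hn => hn.le
  refine ⟨fun n s => ((Complex.Gamma (Complex.exp (Complex.I * s) * θ))⁻¹ +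
      δ n (Complex.exp (Complex.I * s))) / (x + δ n 1) -
      (Complex.Gamma (Complex.exp (Complex.I * s) * θ))⁻¹ / x,
    2 * (‖x‖ + U) / ‖x‖ ^ 2 * C₁, ?_⟩
  filter_upwards [hsmall, eventually_ge_atTop (max n₀ 1)] with n hn1 hn2 s
  have hn : 1 ≤ n := (le_max_right _ _).trans hn2
  have hnc : (n : ℂ) ≠ 0 := Nat.cast_ne_zero.2 (Nat.one_le_iff_ne_zero.1 hn)
  set w : ℂ := Complex.exp (Complex.I * s) with hwdef
  have hw : ‖w‖ = 1 := norm_exp_I_mul s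
  have hαnorm : ‖w * (θ : ℂ)‖ ≤ θ := by
    rw [norm_mul, hw, one_mul, Complex.norm_real, Real.norm_of_nonneg hθ.le]
  obtain ⟨hne, hle⟩ := norm_div_sub_div_le hx0 (hδle n hn2 1 norm_one) (hδle n hn2 w hw)
    (hrise _ hαnorm).1 hn1
  have hqw : ∀ v : ℂ, q n v = p n v * ((Complex.Gamma (v * θ))⁻¹ + δ n v) := fun v => by
    have := hp0 n hn v
    rw [hδ]
    field_simp
    ring
  have hq1 : q n 1 = p n 1 * (x + δ n 1) := by rw [hqw 1, one_mul]
  have hq0 : q n 1 ≠ 0 := by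
    rw [hq1]
    exact mul_ne_zero (hp0 n hn 1) hne
  obtain ⟨hh, hE⟩ := expect_eq_div hΘ hq0 (Complex.I * s)
  refine ⟨hh, ?_, ?_⟩
  · have hE' : expect Θ (fun σ : Equiv.Perm (Fin n) =>
        Complex.exp (Complex.I * (s : ℂ) * (totalCycles σ : ℂ))) = q n w / q n 1 := hE
    have hpp : p n w = (n : ℂ) ^ ((θ : ℂ) * (w - 1)) * Complex.exp (K * (w - 1)) * p n 1 := by
      rw [hp]
      simp only
      rw [show w * (θ : ℂ) - 1 = (θ : ℂ) * (w - 1) + (1 * θ - 1) by ring, Complex.cpow_add _ _ hnc,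
        show w * K = K * (w - 1) + 1 * K by ring, Complex.exp_add]
      ring
    have hΓ : Complex.Gamma (θ : ℂ) / Complex.Gamma ((θ : ℂ) * w) =
        (Complex.Gamma (w * θ))⁻¹ / x := by
      rw [hx, mul_comm w, div_inv_eq_mul, div_eq_mul_inv, mul_comm]
    rw [hE', hqw w, hq1, hΓ, hpp, mul_right_comm, mul_comm (p n 1),
      mul_div_mul_right _ _ (hp0 n hn 1), mul_div_assoc]
    ring
  · rw [mul_assoc]
    exact hle

/-- The coefficient error `n^{θ-1-γ} log n` ignores `Re w`, so the normaliser is `n^{θ-1}` for every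
`w`. The factor `n^{θ(w-1)}`, of modulus at most `1`, stays in the main term `Y`. -/
theorem expect_asymptotic_of_isClassEF {Θ : ℕ → ℝ} (hΘ : ∀ m : ℕ, 1 ≤ m → 0 ≤ Θ m)
    {r θ γ : ℝ} {K : ℂ} (hθ : 0 < θ) (hG : IsClassEF (gSeries Θ) r θ γ K) :
    ∃ (ε : ℕ → ℝ → ℂ) (C : ℝ), ∀ᶠ n : ℕ in atTop, ∀ s : ℝ,
      h Θ n ≠ 0 ∧
      expect Θ (fun σ : Equiv.Perm (Fin n) =>
          Complex.exp (Complex.I * (s : ℂ) * (totalCycles σ : ℂ))) =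
        (n : ℂ) ^ ((θ : ℂ) * (Complex.exp (Complex.I * (s : ℂ)) - 1)) *
          Complex.exp (K * (Complex.exp (Complex.I * (s : ℂ)) - 1)) *
          (Complex.Gamma (θ : ℂ) /
            Complex.Gamma ((θ : ℂ) * Complex.exp (Complex.I * (s : ℂ)))) + ε n s ∧
      ‖ε n s‖ ≤ C * (Real.log (n : ℝ) / (n : ℝ) ^ γ) := by
  obtain ⟨C, hC, hcoeff⟩ := hG.exists_coeff_bound (constantCoeff_gSeries Θ)
  obtain ⟨-, -, hγ, hγ1, -⟩ := hG
  obtain ⟨U, hU, hrise⟩ := exists_bound_risingCoeffNormalized θ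
  set q : ℕ → ℂ → ℂ := fun n w =>
    (r : ℂ) ^ n * PowerSeries.coeff n ((PowerSeries.exp ℂ).subst (w • gSeries Θ)) with hq
  set p : ℕ → ℂ := fun n => (n : ℂ) ^ ((θ : ℂ) - 1) with hp
  set Y : ℕ → ℂ → ℂ := fun n w =>
    (n : ℂ) ^ ((θ : ℂ) * (w - 1)) * Complex.exp (w * K) * (Complex.Gamma (w * θ))⁻¹ with hY
  have hp0 : ∀ n : ℕ, 1 ≤ n → p n ≠ 0 := fun n hn => by
    simp [hp, Complex.cpow_eq_zero_iff, Nat.one_le_iff_ne_zero.1 hn]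
  set C₁ : ℝ := C + 2 * Real.exp ‖K‖ * U with hC₁
  set δ : ℕ → ℂ → ℂ := fun n w => q n w / p n - Y n w with hδ
  have hαnorm : ∀ w : ℂ, ‖w‖ = 1 → ‖w * (θ : ℂ)‖ ≤ θ := fun w hw => by
    rw [norm_mul, hw, one_mul, Complex.norm_real, Real.norm_of_nonneg hθ.le]
  have hpow : ∀ n : ℕ, 1 ≤ n → ∀ w : ℂ, ‖w‖ = 1 → ‖(n : ℂ) ^ ((θ : ℂ) * (w - 1))‖ ≤ 1 := by
    intro n hn w hw
    have hn1 : (1 : ℝ) ≤ n := by exact_mod_cast hn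
    rw [Complex.norm_natCast_cpow_of_pos hn, Complex.re_ofReal_mul]
    refine Real.rpow_le_one_of_one_le_of_nonpos hn1 ?_
    have := (Complex.re_le_norm w).trans_eq hw
    simp only [Complex.sub_re, Complex.one_re]
    nlinarith
  have hδle : ∀ n : ℕ, 2 ≤ n → ∀ w : ℂ, ‖w‖ = 1 →
      ‖δ n w‖ ≤ C₁ * (Real.log n / (n : ℝ) ^ γ) := by
    intro n hn w hw
    have hn1 : 1 ≤ n := by lia
    have hn2 : (2 : ℝ) ≤ n := by exact_mod_cast hn
    have hnpos : (0 : ℝ) < n := by linarith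
    have hnc : (n : ℂ) ≠ 0 := Nat.cast_ne_zero.2 (Nat.one_le_iff_ne_zero.1 hn1)
    have h1 : δ n w = (q n w - Complex.exp (w * K) * risingCoeff (w * θ) n) / p n +
        (n : ℂ) ^ ((θ : ℂ) * (w - 1)) * Complex.exp (w * K) *
          (risingCoeffNormalized (w * θ) n - (Complex.Gamma (w * θ))⁻¹) := by
      have h2 : risingCoeff (w * θ) n =
          risingCoeffNormalized (w * θ) n * ((n : ℂ) ^ ((θ : ℂ) * (w - 1)) * p n) := by
        rw [risingCoeff_eq _ hn1, hp]
        simp only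
        rw [← Complex.cpow_add _ _ hnc]
        congr 2
        ring
      have h3 : (q n w - Complex.exp (w * K) * risingCoeff (w * θ) n) / p n =
          q n w / p n - Complex.exp (w * K) *
            (risingCoeffNormalized (w * θ) n * (n : ℂ) ^ ((θ : ℂ) * (w - 1))) := by
        have h4 : Complex.exp (w * K) * risingCoeff (w * θ) n = Complex.exp (w * K) *
            (risingCoeffNormalized (w * θ) n * (n : ℂ) ^ ((θ : ℂ) * (w - 1))) * p n := by
          rw [h2]
          ring
        rw [h4, sub_div, mul_div_cancel_right₀ _ (hp0 n hn1)]
      rw [h3, hδ, hY]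
      ring
    have hpn : ‖p n‖ = (n : ℝ) ^ (θ - 1) := by
      rw [hp]
      simp only
      rw [Complex.norm_natCast_cpow_of_pos hn1]
      simp
    have h5 := hcoeff n hn w hw
    have h6 := ((hrise _ (hαnorm w hw)).2 n hn1).2
    have h7 : (n : ℝ) ^ (θ - 1 - γ) * Real.log n / (n : ℝ) ^ (θ - 1) =
        Real.log n / (n : ℝ) ^ γ := by
      rw [Real.rpow_sub hnpos (θ - 1)]
      field_simp
    -- The `O(1/n)` error of the model is absorbed using `γ ≤ 1` and `log 2 > 1/2`.
    have h8 : 1 / (n : ℝ) ≤ 2 * (Real.log n / (n : ℝ) ^ γ) := by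
      have h9 : Real.log 2 ≤ Real.log n := Real.log_le_log (by norm_num) hn2
      have h10 := Real.log_two_gt_d9
      have h11 : (n : ℝ) ^ γ ≤ n := by
        calc (n : ℝ) ^ γ ≤ (n : ℝ) ^ (1 : ℝ) :=
              Real.rpow_le_rpow_of_exponent_le (by linarith) hγ1
          _ = n := Real.rpow_one _
      rw [← mul_div_assoc]
      exact div_le_div₀ (by linarith) (by linarith) (by positivity) h11
    rw [h1]
    refine (norm_add_le _ _).trans ?_
    rw [hC₁, add_mul]
    refine add_le_add ?_ ?_
    · rw [norm_div, hpn, ← h7, ← mul_div_assoc]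
      exact div_le_div_of_nonneg_right h5 (by positivity)
    · rw [norm_mul, norm_mul]
      calc _ ≤ 1 * Real.exp ‖K‖ * (U * (1 / n)) :=
            mul_le_mul (mul_le_mul (hpow n hn1 w hw) (norm_exp_mul_le hw K) (norm_nonneg _)
              zero_le_one) h6 (norm_nonneg _) (by positivity)
        _ ≤ 1 * Real.exp ‖K‖ * (U * (2 * (Real.log n / (n : ℝ) ^ γ))) := by gcongr
        _ = _ := by ring
  set x : ℂ := Complex.exp K * (Complex.Gamma θ)⁻¹ with hx
  have hx0 : x ≠ 0 := mul_ne_zero (Complex.exp_ne_zero K)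
    (inv_ne_zero (Complex.Gamma_ne_zero_of_re_pos (by simpa using hθ)))
  have hY1 : ∀ n : ℕ, Y n 1 = x := fun n => by simp [hY, hx]
  have hsmall : ∀ᶠ n : ℕ in atTop, C₁ * (Real.log n / (n : ℝ) ^ γ) ≤ ‖x‖ / 2 := by
    have h1 := ((isLittleO_log_rpow_atTop hγ).tendsto_div_nhds_zero.comp
      tendsto_natCast_atTop_atTop).const_mul C₁
    rw [mul_zero] at h1
    exact (h1.eventually_lt_const (half_pos (norm_pos_iff.2 hx0))).mono fun n hn => hn.le
  refine ⟨fun n s => (Y n (Complex.exp (Complex.I * s)) + δ n (Complex.exp (Complex.I * s))) /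
      (x + δ n 1) - Y n (Complex.exp (Complex.I * s)) / x,
    2 * (‖x‖ + Real.exp ‖K‖ * U) / ‖x‖ ^ 2 * C₁, ?_⟩
  filter_upwards [hsmall, eventually_ge_atTop 2] with n hns hn2 s
  have hn : 1 ≤ n := by lia
  set w : ℂ := Complex.exp (Complex.I * s) with hwdef
  have hw : ‖w‖ = 1 := norm_exp_I_mul s
  have hYle : ‖Y n w‖ ≤ Real.exp ‖K‖ * U := by
    rw [hY]
    simp only
    rw [norm_mul, norm_mul]
    calc _ ≤ 1 * Real.exp ‖K‖ * U :=
          mul_le_mul (mul_le_mul (hpow n hn w hw) (norm_exp_mul_le hw K) (norm_nonneg _)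
            zero_le_one) (hrise _ (hαnorm w hw)).1 (norm_nonneg _) (by positivity)
      _ = _ := by ring
  obtain ⟨hne, hle⟩ := norm_div_sub_div_le hx0 (hδle n hn2 1 norm_one) (hδle n hn2 w hw)
    hYle hns
  have hqw : ∀ v : ℂ, q n v = (Y n v + δ n v) * p n := fun v => by
    rw [hδ]
    simp only
    rw [add_sub_cancel, div_mul_cancel₀ _ (hp0 n hn)]
  have hq1 : q n 1 = (x + δ n 1) * p n := by rw [hqw 1, hY1]
  have hq0 : q n 1 ≠ 0 := by
    rw [hq1]
    exact mul_ne_zero hne (hp0 n hn)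
  obtain ⟨hh, hE⟩ := expect_eq_div hΘ hq0 (Complex.I * s)
  refine ⟨hh, ?_, ?_⟩
  · have hE' : expect Θ (fun σ : Equiv.Perm (Fin n) =>
        Complex.exp (Complex.I * (s : ℂ) * (totalCycles σ : ℂ))) = q n w / q n 1 := hE
    have hYx : (n : ℂ) ^ ((θ : ℂ) * (w - 1)) * Complex.exp (K * (w - 1)) *
        (Complex.Gamma (θ : ℂ) / Complex.Gamma ((θ : ℂ) * w)) = Y n w / x := by
      rw [hY, hx]
      simp only
      rw [show w * K = K * (w - 1) + K by ring, Complex.exp_add, mul_comm w (θ : ℂ),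
        ← mul_assoc ((n : ℂ) ^ _), mul_right_comm _ (Complex.exp K), mul_comm (Complex.exp K),
        mul_div_mul_right _ _ (Complex.exp_ne_zero K), div_inv_eq_mul, div_eq_mul_inv]
      ring
    rw [hE', hqw w, hq1, mul_div_mul_right _ _ (hp0 n hn), hYx]
    ring
  · rw [mul_assoc]
    exact hle

end Expectation

end WeightedPerm

/-! ### The three assertions together -/

theorem mainTheorem3 (Θ : ℕ → ℝ) (hΘ : ∀ m : ℕ, 1 ≤ m → 0 ≤ Θ m) :
    (∀ w : ℂ,
      (PowerSeries.mk fun n : ℕ => (WeightedPerm.h Θ n : ℂ) *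
          WeightedPerm.expect Θ (fun σ : Equiv.Perm (Fin n) =>
            Complex.exp (w * (WeightedPerm.totalCycles σ : ℂ)))) =
        (PowerSeries.mk fun n : ℕ => (WeightedPerm.h Θ n : ℂ) *
          WeightedPerm.expect Θ (fun σ : Equiv.Perm (Fin n) =>
            Complex.exp (w * ∑ m ∈ Finset.Icc 1 n, (WeightedPerm.cycleCount m σ : ℂ)))) ∧
      (PowerSeries.mk fun n : ℕ => (WeightedPerm.h Θ n : ℂ) *
          WeightedPerm.expect Θ (fun σ : Equiv.Perm (Fin n) =>
            Complex.exp (w * ∑ m ∈ Finset.Icc 1 n, (WeightedPerm.cycleCount m σ : ℂ)))) =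
        (PowerSeries.exp ℂ).subst (Complex.exp w • WeightedPerm.gSeries Θ)) ∧
    (∀ (r ϑ : ℝ) (K : ℂ), 0 < ϑ → WeightedPerm.IsClassF (WeightedPerm.gSeries Θ) r ϑ K →
      ∃ (ε : ℕ → ℝ → ℂ) (C : ℝ), ∀ᶠ n : ℕ in Filter.atTop, ∀ s : ℝ,
        WeightedPerm.h Θ n ≠ 0 ∧
        WeightedPerm.expect Θ (fun σ : Equiv.Perm (Fin n) =>
            Complex.exp (Complex.I * (s : ℂ) * (WeightedPerm.totalCycles σ : ℂ))) =
          (n : ℂ) ^ ((ϑ : ℂ) * (Complex.exp (Complex.I * (s : ℂ)) - 1)) *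
            Complex.exp (K * (Complex.exp (Complex.I * (s : ℂ)) - 1)) *
            (Complex.Gamma (ϑ : ℂ) /
              Complex.Gamma ((ϑ : ℂ) * Complex.exp (Complex.I * (s : ℂ))) + ε n s) ∧
        ‖ε n s‖ ≤ C * (1 / (n : ℝ))) ∧
    (∀ (r ϑ γ : ℝ) (K : ℂ), 0 < ϑ → WeightedPerm.IsClassEF (WeightedPerm.gSeries Θ) r ϑ γ K →
      ∃ (ε : ℕ → ℝ → ℂ) (C : ℝ), ∀ᶠ n : ℕ in Filter.atTop, ∀ s : ℝ,
        WeightedPerm.h Θ n ≠ 0 ∧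
        WeightedPerm.expect Θ (fun σ : Equiv.Perm (Fin n) =>
            Complex.exp (Complex.I * (s : ℂ) * (WeightedPerm.totalCycles σ : ℂ))) =
          (n : ℂ) ^ ((ϑ : ℂ) * (Complex.exp (Complex.I * (s : ℂ)) - 1)) *
            Complex.exp (K * (Complex.exp (Complex.I * (s : ℂ)) - 1)) *
            (Complex.Gamma (ϑ : ℂ) /
              Complex.Gamma ((ϑ : ℂ) * Complex.exp (Complex.I * (s : ℂ)))) + ε n s ∧
        ‖ε n s‖ ≤ C * (Real.log (n : ℝ) / (n : ℝ) ^ γ)) := by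
  refine ⟨fun w => ?_, fun r ϑ K hϑ hG => WeightedPerm.expect_asymptotic_of_isClassF hΘ hϑ hG,
    fun r ϑ γ K hϑ hG => WeightedPerm.expect_asymptotic_of_isClassEF hΘ hϑ hG⟩
  have h1 : (PowerSeries.mk fun n : ℕ => (WeightedPerm.h Θ n : ℂ) *
      WeightedPerm.expect Θ (fun σ : Equiv.Perm (Fin n) =>
        Complex.exp (w * ∑ m ∈ Finset.Icc 1 n, (WeightedPerm.cycleCount m σ : ℂ)))) =
      PowerSeries.mk fun n : ℕ => (WeightedPerm.h Θ n : ℂ) *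
        WeightedPerm.expect Θ (fun σ : Equiv.Perm (Fin n) =>
          Complex.exp (w * (WeightedPerm.totalCycles σ : ℂ))) := by
    simp only [WeightedPerm.totalCycles, Nat.cast_sum]
  rw [h1]
  exact ⟨rfl, WeightedPerm.mk_h_mul_expect hΘ w⟩
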